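/- **Setting.** Let $A'\in\mathbb R^{m'\times n'}$, $b'\in\mathbb R^{m'}$, $c'\in\mathbb R^{n'}$ be the data of the primal–dual pair $(P')$: $\min c'^Tx$, $A'x\ge b'$, $x\ge 0$, and $(D')$: $\max b'^Ty$, $A'^Ty\le c'$, $y\ge 0$. Put $N=n'+m'+2$, $\bar b=b'-A'e+e$, $\bar c=A'^Te+e-c'$, $\bar o=1+c'^Te-b'^Te$. The self-dual embedding is $$\min\ N\gamma\quad\text{s.t. } u=A'x-b'\tau+\bar b\gamma,\ \ s=-A'^Ty+c'\tau+\bar c\gamma,\ \ \phi=b'^Ty-c'^Tx+\bar o\gamma,\ \ \rho=-\bar b^Ty-\bar c^Tx-\bar o\tau+N,$$ with all of $y,x,\tau,\gamma,u,s,\phi,\rho\ge 0$. Write $\mathcal X=(w;z)$ with $w=(u;s;\phi;\rho)$, $z=(y;x;\tau;\gamma)$, and $\mu(\mathcal X)=z^Tw/N$. Let $\mathcal{PD}$ be the feasible set, $\mathcal{PD}_\zeta=\{\mathcal X\in\mathcal{PD}:\mu(\mathcal X)\le\zeta\}$, and $\mathcal N(\theta)=\{\mathcal X\in\mathcal{PD}: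 z,w>0,\ \|(z_iw_i-\mu)_i\|_2\le\theta\mu\}$. **Algorithm.** Let $\eta=0.1$, $\beta=1-0.11/\sqrt N$, and $\theta=0.2$ (IF-IPM) or $\theta=0.3$ (IF-QIPM). Let $\mathcal V$ be the matrix whose columns form the standard basis of the null space of the constraint matrix: writing the equalities as $w=Mz+q$, with $M$ skew-symmetric, $\mathcal V=\begin{bmatrix}-M\\-I\end{bmatrix}$. Let $\mathcal D=[\operatorname{diag}(z)\ \operatorname{diag}(w)]$ and $\mathcal R=\beta\mu e-(z_iw_i)_i$. Start at some $\mathcal X^0\in\mathcal N(\theta)$; in iteration $k$, solve the OSS system $\mathcal D\mathcal V\lambda=\mathcal R$ at $\mathcal X^k$ inexactly, obtaining $\tilde\lambda$ with residual $\|\mathcal D\mathcal V\tilde\lambda-\mathcal R\|_2\le\eta\mu_k$ or with error $\|\tilde\lambda-\lambda\|_2\le\eta\mu_k/\|\mathcal D\mathcal V\|_2$ from an exact solution $\lambda$, and set $\mathcal X^{k+1}=\mathcal X^k+\mathcal V\tilde\lambda$. Write $\mu_k=\mu(\mathcal X^k)$. (A stopping test $\mathcal X^k\in\mathcal{PD}_\zeta$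 only truncates this sequence.) **Theorem.** There is an absolute constant $C>0$ such that for both values of $\theta$ and all $m',n',A',b',c'$ the following holds. The all-one vector lies in $\mathcal N(\theta)$ and has $\mu=1$; an iteration can be performed from every point of $\mathcal N(\theta)$; and for every sequence $(\mathcal X^k)_{k\ge0}$ produced as above: 1. $\mu_k\to0$ linearly, with $\mu_{k+1}\le(1-\tfrac{0.01}{\sqrt N})\mu_k$ for all $k$. 2. $\mathcal X^k\in\mathcal N(\theta)$ for all $k$. 3. Let $\kappa$ satisfy $n'+m'+2\le\kappa n'$, and let $\zeta>0$. Then $\mathcal X^k\in\mathcal{PD}_\zeta$ for every integer $k\ge C\sqrt{\kappa}\,\sqrt{n'}\,\log(\mu_0/\zeta)$. If $\mu_0\le1$ (in particular, if the start is the all-one vector), then $\mathcal X^k\in\mathcal{PD}_\zeta$ for every integer $k\ge C\sqrt{\kappa}\,\sqrt{n'}\,\log(1/\zeta)$. That is, $O(\sqrt{n'}\log(1/\zeta))$ iterations suffice when $m'=O(n')$, and $O(\sqrt{n'+m'+2}\,\log(1/\zeta))$ in general for $n'\ge1$. 4. Suppose moreover that $\mu_0\le 1$ and that $A',b',c'$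 are integral, of binary length $$L=m'n'+m'+n'+\sum_{i,j}\lceil\log_2(|a'_{ij}|+1)\rceil+\sum_j\lceil\log_2(|c'_j|+1)\rceil+\sum_i\lceil\log_2(|b'_i|+1)\rceil.$$ Then for every integer $k\ge C\sqrt{\kappa}\,\sqrt{n'}\,L$, rounding $\mathcal X^k$ gives an exact optimal solution. Precisely, consider the affine set of all $(w;z)$ that satisfy the equality constraints of the embedding, $z_i=0$ whenever $z^k_i\le w^k_i$, and $w_i=0$ whenever $z^k_i>w^k_i$. Then this set has a unique point $(w^*;z^*)$ nearest to $\mathcal X^k$ in Euclidean norm, and this point is a strictly complementary optimal solution of the embedding. If $\tau^*>0$, then $x^*/\tau^*$ and $y^*/\tau^*$ are optimal for $(P')$ and $(D')$; if $\tau^*=0$, then $(P')$ or $(D')$ is infeasible. -/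

import Mathlib

open Filter Topology

noncomputable section

namespace SelfDual

/-- Index set of the four blocks `(y, x, τ, γ)` (equally of `(u, s, φ, ρ)`), with `y, u ∈ ℝ^m`,
`x, s ∈ ℝ^n` and `τ, γ, φ, ρ ∈ ℝ`. -/
abbrev Idx (m n : ℕ) : Type := Fin m ⊕ (Fin n ⊕ (Unit ⊕ Unit))

/-- Position of `τ` (and of its slack `φ`). -/
def iTau (m n : ℕ) : Idx m n := Sum.inr (Sum.inr (Sum.inl ()))

/-- Position of `γ` (and of its slack `ρ`). -/
def iGam (m n : ℕ) : Idx m n := Sum.inr (Sum.inr (Sum.inr ()))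

/-- A vector `𝒳 = (u; s; φ; ρ; y; x; τ; γ)`. The left half holds the slacks. -/
abbrev Point (m n : ℕ) : Type := Idx m n ⊕ Idx m n → ℝ

/-- The block `w = (u; s; φ; ρ)` of `𝒳`. -/
def slk {m n : ℕ} (Z : Point m n) : Idx m n → ℝ := fun i => Z (Sum.inl i)

/-- The block `z = (y; x; τ; γ)` of `𝒳`. -/
def var {m n : ℕ} (Z : Point m n) : Idx m n → ℝ := fun i => Z (Sum.inr i)

/-- The `x`-part of `𝒳`. -/
def xPart {m n : ℕ} (Z : Point m n) : Fin n → ℝ := fun j => var Z (Sum.inr (Sum.inl j))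

/-- The `y`-part of `𝒳`. -/
def yPart {m n : ℕ} (Z : Point m n) : Fin m → ℝ := fun i => var Z (Sum.inl i)

/-- Size `n + m + 2` of the embedding. -/
def dim (m n : ℕ) : ℝ := (n : ℝ) + m + 2

/-- Euclidean norm of a real vector. -/
def norm2 {ι : Type} [Fintype ι] (v : ι → ℝ) : ℝ := Real.sqrt (∑ i, v i ^ 2)

section Embedding

variable {m n : ℕ} (A : Matrix (Fin m) (Fin n) ℝ) (b : Fin m → ℝ) (c : Fin n → ℝ)

/-- `b̄ = b - A e + e`. -/
def bBar : Fin m → ℝ := fun i => b i - (∑ j, A i j) + 1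

/-- `c̄ = Aᵀ e + e - c`. -/
def cBar : Fin n → ℝ := fun j => (∑ i, A i j) + 1 - c j

/-- `ō = 1 + cᵀ e - bᵀ e`. -/
def oBar : ℝ := 1 + (∑ j, c j) - ∑ i, b i

/-- The skew-symmetric coefficient matrix of the self-dual model, rows and columns ordered as
`(y, x, τ, γ)`:
`[0, A, -b, b̄; -Aᵀ, 0, c, c̄; bᵀ, -cᵀ, 0, ō; -b̄ᵀ, -c̄ᵀ, -ō, 0]`. -/
def sdMatrix : Matrix (Idx m n) (Idx m n) ℝ := Matrix.of fun p q =>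
  match p, q with
  | Sum.inl i, Sum.inr (Sum.inl j) => A i j
  | Sum.inl i, Sum.inr (Sum.inr (Sum.inl _)) => -b i
  | Sum.inl i, Sum.inr (Sum.inr (Sum.inr _)) => bBar A b i
  | Sum.inr (Sum.inl j), Sum.inl i => -A i j
  | Sum.inr (Sum.inl j), Sum.inr (Sum.inr (Sum.inl _)) => c j
  | Sum.inr (Sum.inl j), Sum.inr (Sum.inr (Sum.inr _)) => cBar A c j
  | Sum.inr (Sum.inr (Sum.inl _)), Sum.inl i => b i
  | Sum.inr (Sum.inr (Sum.inl _)), Sum.inr (Sum.inl j) => -c j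
  | Sum.inr (Sum.inr (Sum.inl _)), Sum.inr (Sum.inr (Sum.inr _)) => oBar b c
  | Sum.inr (Sum.inr (Sum.inr _)), Sum.inl i => -bBar A b i
  | Sum.inr (Sum.inr (Sum.inr _)), Sum.inr (Sum.inl j) => -cBar A c j
  | Sum.inr (Sum.inr (Sum.inr _)), Sum.inr (Sum.inr (Sum.inl _)) => -oBar b c
  | _, _ => 0

/-- The vector `(0; 0; 0; n + m + 2)`. -/
def sdRhs (m n : ℕ) : Idx m n → ℝ := fun p => if p = iGam m n then dim m n else 0

/-- The equality constraints of the self-dual model with slacks: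
`u = A x - b τ + b̄ γ`, `s = -Aᵀ y + c τ + c̄ γ`, `φ = bᵀ y - cᵀ x + ō γ`,
`ρ = -b̄ᵀ y - c̄ᵀ x - ō τ + (n + m + 2)`. -/
def SatisfiesEqs (Z : Point m n) : Prop :=
  slk Z = (sdMatrix A b c).mulVec (var Z) + sdRhs m n

/-- The feasible set `𝒫𝒟` of the self-dual model. -/
def feasible : Set (Point m n) :=
  {Z | SatisfiesEqs A b c Z ∧ (∀ i, 0 ≤ var Z i) ∧ ∀ i, 0 ≤ slk Z i}

/-- The interior feasible set `𝒫𝒟⁰`. -/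
def interiorFeasible : Set (Point m n) :=
  {Z | Z ∈ feasible A b c ∧ (∀ i, 0 < var Z i) ∧ ∀ i, 0 < slk Z i}

/-- `μ = (xᵀ s + yᵀ u + τ φ + γ ρ) / (n + m + 2)`. -/
def mu (Z : Point m n) : ℝ := (∑ i, var Z i * slk Z i) / dim m n

/-- The set `𝒫𝒟_ζ` of `ζ`-optimal solutions. -/
def zetaOptimal (ζ : ℝ) : Set (Point m n) := {Z | Z ∈ feasible A b c ∧ mu Z ≤ ζ}

/-- The neighborhood `𝒩(θ)` of the central path. -/
def nbhd (θ : ℝ) : Set (Point m n) :=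
  {Z | Z ∈ interiorFeasible A b c ∧
    norm2 (fun i => var Z i * slk Z i - mu Z) ≤ θ * mu Z}

/-- The starting point in which all components are one. -/
def ones (m n : ℕ) : Point m n := fun _ => 1

/-- The matrix `𝒱`, whose columns form a basis of the null space of the constraint matrix
acting on `(u; s; φ; ρ; y; x; τ; γ)`: the negative of `sdMatrix` on top of `-I`. -/
def calV : Matrix (Idx m n ⊕ Idx m n) (Idx m n) ℝ :=
  Matrix.fromRows (-sdMatrix A b c) (-1)

/-- The matrix `𝒟`, i.e. `diag (y; x; τ; γ)` followed by `diag (u; s; φ; ρ)`. -/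
def calD (Z : Point m n) : Matrix (Idx m n) (Idx m n ⊕ Idx m n) ℝ :=
  Matrix.fromCols (Matrix.diagonal (var Z)) (Matrix.diagonal (slk Z))

/-- `η = 0.1`. -/
def eta : ℝ := 1 / 10

/-- `β = 1 - 0.11 / √(n + m + 2)`. -/
def beta (m n : ℕ) : ℝ := 1 - (11 / 100) / Real.sqrt (dim m n)

/-- The right-hand side `ℛ = β μ e - (Y u; X s; τ φ; γ ρ)`. -/
def calR (Z : Point m n) : Idx m n → ℝ := fun i => beta m n * mu Z - var Z i * slk Z i

/-- The coefficient matrix `𝒟𝒱` of the orthogonal subspaces system `𝒟𝒱 lam = ℛ`. -/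
def oss (Z : Point m n) : Matrix (Idx m n) (Idx m n) ℝ := calD Z * calV A b c

/-- `lam` is accepted as an inexact solution of the orthogonal subspaces system at `Z`: either its
residual is at most `η μ`, or its distance to an exact solution is at most `η μ / ‖𝒟𝒱‖₂`
(spectral norm). -/
def Accepted (Z : Point m n) (lam : Idx m n → ℝ) : Prop :=
  norm2 ((oss A b c Z).mulVec lam - calR Z) ≤ eta * mu Z ∨
  ∃ lamEx : Idx m n → ℝ, (oss A b c Z).mulVec lamEx = calR Z ∧
    norm2 (lam - lamEx) ≤ eta * mu Z / ‖Matrix.toEuclideanCLM (𝕜 := ℝ) (oss A b c Z)‖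

/-- One pass of the loop: solve the orthogonal subspaces system inexactly, then take the full
step `Δ𝒳 = 𝒱 lam`. -/
def Step (Z Znext : Point m n) : Prop :=
  ∃ lam : Idx m n → ℝ, Accepted A b c Z lam ∧ Znext = Z + (calV A b c).mulVec lam

/-- A sequence of iterates: it starts at some point of `𝒩(θ)` and repeats the loop body. -/
def IsRun (θ : ℝ) (X : ℕ → Point m n) : Prop :=
  X 0 ∈ nbhd A b c θ ∧ ∀ k, Step A b c (X k) (X (k + 1))

/-- The affine set of all points that satisfy the equality constraints, have `z_i = 0` where
`z_i ≤ w_i` holds at `Z`, and have `w_i = 0` where `z_i > w_i` holds at `Z`. -/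
def guessedFace (Z : Point m n) : Set (Point m n) :=
  {P | SatisfiesEqs A b c P ∧
    ∀ i, (var Z i ≤ slk Z i → var P i = 0) ∧ (slk Z i < var Z i → slk P i = 0)}

/-- `P` is the rounding of `Z`: a point of the affine set `guessedFace` nearest to `Z` in the
Euclidean norm. -/
def IsRounding (Z P : Point m n) : Prop :=
  P ∈ guessedFace A b c Z ∧ ∀ Q ∈ guessedFace A b c Z, norm2 (P - Z) ≤ norm2 (Q - Z)

/-- `P` is a strictly complementary (exact) optimal solution of the self-dual model
`min (n + m + 2) γ`. -/
def IsStrictOptimal (P : Point m n) : Prop :=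
  P ∈ feasible A b c ∧
  (∀ Q ∈ feasible A b c,
    dim m n * var P (iGam m n) ≤ dim m n * var Q (iGam m n)) ∧
  ∀ i, var P i * slk P i = 0 ∧ 0 < var P i + slk P i

/-- Feasible set of the primal problem `min cᵀ x`, `A x ≥ b`, `x ≥ 0`. -/
def primalFeasible : Set (Fin n → ℝ) := {x | (∀ i, b i ≤ A.mulVec x i) ∧ ∀ j, 0 ≤ x j}

/-- Feasible set of the dual problem `max bᵀ y`, `Aᵀ y ≤ c`, `y ≥ 0`. -/
def dualFeasible : Set (Fin m → ℝ) :=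
  {y | (∀ j, A.transpose.mulVec y j ≤ c j) ∧ ∀ i, 0 ≤ y i}

/-- `x` is an optimal solution of the primal problem. -/
def IsPrimalOptimal (x : Fin n → ℝ) : Prop :=
  x ∈ primalFeasible A b ∧ ∀ v ∈ primalFeasible A b, c ⬝ᵥ x ≤ c ⬝ᵥ v

/-- `y` is an optimal solution of the dual problem. -/
def IsDualOptimal (y : Fin m → ℝ) : Prop :=
  y ∈ dualFeasible A c ∧ ∀ v ∈ dualFeasible A c, b ⬝ᵥ v ≤ b ⬝ᵥ y

end Embedding

/-- Binary length of integer data: `mn + m + n + ∑ ⌈log₂(|a_ij| + 1)⌉ + ∑ ⌈log₂(|c_j| + 1)⌉ +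
∑ ⌈log₂(|b_i| + 1)⌉`. Here `Nat.clog 2 t` is `⌈log₂ t⌉`. -/
def binaryLength {m n : ℕ} (A : Matrix (Fin m) (Fin n) ℤ) (b : Fin m → ℤ) (c : Fin n → ℤ) : ℕ :=
  m * n + m + n + (∑ i, ∑ j, Nat.clog 2 ((A i j).natAbs + 1))
    + (∑ j, Nat.clog 2 ((c j).natAbs + 1)) + ∑ i, Nat.clog 2 ((b i).natAbs + 1)

end SelfDual

end

/-!
Along a step `z + Δz`, `w + Δw` of the embedding, `Δw` is a skew-symmetric image of `Δz`, so
`Δz ⬝ᵥ Δw = 0`. Hence `μ` changes only through the linearized complementarity equations, whose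
residual is at most `η μ`, while the products `Δzᵢ Δwᵢ`, which are all that linearization misses,
are quadratically small inside `𝒩(θ)`. This gives both the decrease of `μ` and the invariance
of `𝒩(θ)`.

Orthogonality to the all-one solution shows that the iterates are bounded, and orthogonality to a
cluster point, together with `zᵢ wᵢ ≥ (1 - θ) μ`, shows that every cluster point of the run is a
strictly complementary optimal solution.

For integral data, Cramer's rule bounds the nonzero coordinates of basic optimal solutions below
by `1 / minorBound`. Once `μ` is smaller than a fixed power of that quantity, comparing `zᵢ` with
`wᵢ` reveals the optimal partition. The iterate is then so close to the optimal face that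
projecting onto its affine hull keeps the basic coordinates positive.
-/

namespace SelfDual

open scoped BigOperators Matrix

section Norm

variable {ι : Type} [Fintype ι]

lemma norm2_eq_norm (v : ι → ℝ) : norm2 v = ‖WithLp.toLp 2 v‖ := by
  simp [norm2, EuclideanSpace.norm_eq]

lemma norm2_nonneg (v : ι → ℝ) : 0 ≤ norm2 v := Real.sqrt_nonneg _

lemma norm2_sq (v : ι → ℝ) : norm2 v ^ 2 = ∑ i, v i ^ 2 :=
  Real.sq_sqrt (Finset.sum_nonneg fun _ _ => sq_nonneg _)

lemma norm2_add_le (v v' : ι → ℝ) : norm2 (v + v') ≤ norm2 v + norm2 v' := by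
  simp only [norm2_eq_norm, WithLp.toLp_add]
  exact norm_add_le _ _

lemma abs_le_norm2 (v : ι → ℝ) (i : ι) : |v i| ≤ norm2 v :=
  Real.abs_le_sqrt <| Finset.single_le_sum (f := fun i => v i ^ 2)
    (fun _ _ => sq_nonneg _) (Finset.mem_univ i)

lemma norm2_le_sum_abs (v : ι → ℝ) : norm2 v ≤ ∑ i, |v i| := by
  refine Real.sqrt_le_iff.2 ⟨Finset.sum_nonneg fun _ _ => abs_nonneg _, ?_⟩
  simpa only [sq_abs] using
    Finset.sum_sq_le_sq_sum_of_nonneg (s := Finset.univ) fun i _ => abs_nonneg (v i)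

lemma norm2_mulVec_le [DecidableEq ι] (B : Matrix ι ι ℝ) (v : ι → ℝ) :
    norm2 (B.mulVec v) ≤ ‖Matrix.toEuclideanCLM (𝕜 := ℝ) B‖ * norm2 v := by
  rw [norm2_eq_norm, norm2_eq_norm, ← Matrix.toEuclideanCLM_toLp]
  exact ContinuousLinearMap.le_opNorm _ _

lemma norm2_sub_const_sq (v : ι → ℝ) (a : ℝ) :
    norm2 (fun i => v i - a) ^ 2 =
      norm2 (fun i => v i - 𝔼 j, v j) ^ 2 + Fintype.card ι * (𝔼 j, v j - a) ^ 2 := by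
  set ν := 𝔼 j, v j
  have hmean : ∑ i, (v i - ν) = 0 := by
    rw [Finset.sum_sub_distrib, Finset.sum_const, Finset.card_univ, nsmul_eq_mul,
      Fintype.card_mul_expect, sub_self]
  calc norm2 (fun i => v i - a) ^ 2
      = ∑ i, ((v i - ν) ^ 2 + 2 * (ν - a) * (v i - ν) + (ν - a) ^ 2) := by
        rw [norm2_sq]
        exact Finset.sum_congr rfl fun i _ => by ring
    _ = norm2 (fun i => v i - ν) ^ 2 + Fintype.card ι * (ν - a) ^ 2 := by
        rw [Finset.sum_add_distrib, Finset.sum_add_distrib, ← Finset.mul_sum, hmean, norm2_sq,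
          Finset.sum_const, Finset.card_univ, nsmul_eq_mul, mul_zero, add_zero]

lemma norm2_sub_expect_le (v : ι → ℝ) : norm2 (fun i => v i - 𝔼 j, v j) ≤ norm2 v := by
  refine (sq_le_sq₀ (norm2_nonneg _) (norm2_nonneg _)).1 ?_
  have h := norm2_sub_const_sq v 0
  simp only [sub_zero] at h
  rw [h]
  exact le_add_of_nonneg_right (by positivity)

lemma abs_expect_le_norm2_div_sqrt_card (v : ι → ℝ) :
    |𝔼 i, v i| ≤ norm2 v / √(Fintype.card ι) := by
  rcases isEmpty_or_nonempty ι with _ | _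
  · simp
  have hcard : (0 : ℝ) < Fintype.card ι := by exact_mod_cast Fintype.card_pos
  have h := norm2_sub_const_sq v 0
  simp only [sub_zero] at h
  rw [le_div_iff₀ (by positivity)]
  refine (sq_le_sq₀ (by positivity) (norm2_nonneg v)).1 ?_
  rw [mul_pow, sq_abs, Real.sq_sqrt hcard.le, h]
  linarith [sq_nonneg (norm2 fun i => v i - 𝔼 j, v j)]

end Norm

section NewtonStep

variable {ι : Type} {z w dz dw : ι → ℝ}

/-- The residual of the direction `(dz, dw)` in the linearization `z dw + w dz = t - z w` of the
equations `z_i w_i = t`. -/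
def newtonResidual (z w dz dw : ι → ℝ) (t : ℝ) : ι → ℝ :=
  fun i => z i * dw i + w i * dz i - (t - z i * w i)

lemma mul_add_eq_add_newtonResidual (t : ℝ) (i : ι) :
    (z i + dz i) * (w i + dw i) = t + newtonResidual z w dz dw t i + dz i * dw i := by
  simp only [newtonResidual]
  ring

lemma pos_and_pos_of_mul_pos_of_cross_pos {a b a' b' : ℝ} (ha : 0 < a) (hb : 0 < b)
    (hmul : 0 < a' * b') (hcross : 0 < a * b' + b * a') : 0 < a' ∧ 0 < b' := by
  rcases mul_pos_iff.1 hmul with h | ⟨ha', hb'⟩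
  · exact h
  · linarith [mul_neg_of_pos_of_neg ha hb', mul_neg_of_pos_of_neg hb ha']

variable [Fintype ι] {l θ σ η : ℝ}

lemma norm2_mul_le_of_orthogonal (hl : 0 < l) (hzw : ∀ i, l ≤ z i * w i)
    (horth : dz ⬝ᵥ dw = 0) :
    norm2 (fun i => dz i * dw i) ≤ norm2 (fun i => z i * dw i + w i * dz i) ^ 2 / (2 * l) := by
  -- `(z dw + w dz)² ≥ 4 (z w) (dz dw)`; the terms `dz dw` on the left have sum zero
  have hterm (i : ι) :
      |dz i * dw i| + dz i * dw i ≤ (z i * dw i + w i * dz i) ^ 2 / (2 * l) := by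
    rw [le_div_iff₀ (by positivity)]
    rcases le_total 0 (dz i * dw i) with h | h
    · rw [abs_of_nonneg h]
      nlinarith [sq_nonneg (z i * dw i - w i * dz i), mul_le_mul_of_nonneg_right (hzw i) h]
    · rw [abs_of_nonpos h, neg_add_cancel, zero_mul]
      positivity
  calc norm2 (fun i => dz i * dw i)
      ≤ ∑ i, |dz i * dw i| := norm2_le_sum_abs _
    _ = ∑ i, (|dz i * dw i| + dz i * dw i) := by
        rw [Finset.sum_add_distrib, ← dotProduct, horth, add_zero]
    _ ≤ ∑ i, (z i * dw i + w i * dz i) ^ 2 / (2 * l) := Finset.sum_le_sum fun i _ => hterm i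
    _ = norm2 (fun i => z i * dw i + w i * dz i) ^ 2 / (2 * l) := by
        rw [norm2_sq, Finset.sum_div]

lemma expect_step_eq [Nonempty ι] (t : ℝ) (horth : dz ⬝ᵥ dw = 0) :
    𝔼 i, (z i + dz i) * (w i + dw i) = t + 𝔼 i, newtonResidual z w dz dw t i := by
  have hmean : 𝔼 i, dz i * dw i = 0 := by
    rw [Fintype.expect_eq_sum_div_card, ← dotProduct, horth, zero_div]
  simp only [mul_add_eq_add_newtonResidual t, Finset.expect_add_distrib,
    Fintype.expect_const, hmean, add_zero]

lemma norm2_step_sub_expect_le [Nonempty ι] (t : ℝ) (hl : 0 < l) (hzw : ∀ i, l ≤ z i * w i)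
    (horth : dz ⬝ᵥ dw = 0) :
    norm2 (fun i => (z i + dz i) * (w i + dw i) - 𝔼 j, (z j + dz j) * (w j + dw j)) ≤
      norm2 (newtonResidual z w dz dw t) +
        norm2 (fun i => z i * dw i + w i * dz i) ^ 2 / (2 * l) := by
  set r := newtonResidual z w dz dw t
  have hsplit : (fun i => (z i + dz i) * (w i + dw i) - 𝔼 j, (z j + dz j) * (w j + dw j)) =
      (fun i => r i - 𝔼 j, r j) + fun i => dz i * dw i := by
    funext i
    rw [expect_step_eq t horth, mul_add_eq_add_newtonResidual t, Pi.add_apply]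
    ring
  rw [hsplit]
  exact (norm2_add_le _ _).trans
    (add_le_add (norm2_sub_expect_le r) (norm2_mul_le_of_orthogonal hl hzw horth))

lemma mul_le_of_norm2_sub_le {v : ι → ℝ} {μ : ℝ} (h : norm2 (fun i => v i - μ) ≤ θ * μ)
    (i : ι) : (1 - θ) * μ ≤ v i := by
  linarith [neg_le_of_abs_le ((abs_le_norm2 (fun i => v i - μ) i).trans h)]

lemma norm2_sub_centering_le {v : ι → ℝ}
    (hμ : 0 ≤ 𝔼 i, v i) (hnear : norm2 (fun i => v i - 𝔼 j, v j) ≤ θ * 𝔼 j, v j) :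
    norm2 (fun i => v i - (1 - σ / √(Fintype.card ι)) * 𝔼 j, v j) ≤
      √(θ ^ 2 + σ ^ 2) * 𝔼 j, v j := by
  rcases isEmpty_or_nonempty ι with _ | _
  · simp [norm2]
  have hcard : (0 : ℝ) < Fintype.card ι := by exact_mod_cast Fintype.card_pos
  refine (sq_le_sq₀ (norm2_nonneg _) (by positivity)).1 ?_
  set μ := 𝔼 j, v j
  have hsq : norm2 (fun i => v i - μ) ^ 2 ≤ (θ * μ) ^ 2 := by
    gcongr
    exact norm2_nonneg _
  have hshift : Fintype.card ι * (μ - (1 - σ / √(Fintype.card ι)) * μ) ^ 2 = σ ^ 2 * μ ^ 2 := by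
    have hs : √(Fintype.card ι : ℝ) ^ 2 = Fintype.card ι := Real.sq_sqrt hcard.le
    have hs0 : √(Fintype.card ι : ℝ) ≠ 0 := by positivity
    rw [← hs, Real.sqrt_sq (Real.sqrt_nonneg _)]
    field_simp
    ring
  rw [norm2_sub_const_sq, hshift, mul_pow, Real.sq_sqrt (by positivity)]
  linarith [mul_pow θ μ 2]

lemma expect_step_mem_Icc [Nonempty ι] (horth : dz ⬝ᵥ dw = 0)
    (hres : norm2 (newtonResidual z w dz dw ((1 - σ / √(Fintype.card ι)) * 𝔼 i, z i * w i)) ≤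
      η * 𝔼 i, z i * w i) :
    𝔼 i, (z i + dz i) * (w i + dw i) ∈
      Set.Icc ((1 - (σ + η) / √(Fintype.card ι)) * 𝔼 i, z i * w i)
        ((1 - (σ - η) / √(Fintype.card ι)) * 𝔼 i, z i * w i) := by
  have hmean := abs_le.1 <| (abs_expect_le_norm2_div_sqrt_card _).trans
    (div_le_div_of_nonneg_right hres (Real.sqrt_nonneg (Fintype.card ι)))
  rw [expect_step_eq _ horth]
  constructor
  · calc _ = (1 - σ / √(Fintype.card ι)) * (𝔼 i, z i * w i) +
          -(η * (𝔼 i, z i * w i) / √(Fintype.card ι)) := by ring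
      _ ≤ _ := by gcongr; exact hmean.1
  · calc _ ≤ (1 - σ / √(Fintype.card ι)) * (𝔼 i, z i * w i) +
          η * (𝔼 i, z i * w i) / √(Fintype.card ι) := by gcongr; exact hmean.2
      _ = _ := by ring

lemma norm2_direction_le (hμ : 0 ≤ 𝔼 i, z i * w i)
    (hnear : norm2 (fun i => z i * w i - 𝔼 j, z j * w j) ≤ θ * 𝔼 j, z j * w j)
    (hres : norm2 (newtonResidual z w dz dw ((1 - σ / √(Fintype.card ι)) * 𝔼 i, z i * w i)) ≤
      η * 𝔼 i, z i * w i) :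
    norm2 (fun i => z i * dw i + w i * dz i) ≤ (√(θ ^ 2 + σ ^ 2) + η) * 𝔼 i, z i * w i := by
  set t := (1 - σ / √(Fintype.card ι)) * 𝔼 i, z i * w i
  have hsplit : (fun i => z i * dw i + w i * dz i) =
      (fun i => t - z i * w i) + newtonResidual z w dz dw t := by
    funext i
    simp only [newtonResidual, Pi.add_apply]
    ring
  have hcenter : norm2 (fun i => t - z i * w i) = norm2 fun i => z i * w i - t := by
    simp only [norm2, sub_sq_comm t]
  rw [hsplit, add_mul]
  refine (norm2_add_le _ _).trans (add_le_add ?_ hres)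
  rw [hcenter]
  exact norm2_sub_centering_le hμ hnear

lemma norm2_step_sub_expect_le_mul [Nonempty ι] (hμ : 0 < 𝔼 i, z i * w i) (hθ₀ : 0 ≤ θ)
    (hθ₁ : θ < 1)
    (hcontract : η + (√(θ ^ 2 + σ ^ 2) + η) ^ 2 / (2 * (1 - θ)) ≤
      θ * (1 - (σ + η) / √(Fintype.card ι)))
    (hnear : norm2 (fun i => z i * w i - 𝔼 j, z j * w j) ≤ θ * 𝔼 j, z j * w j)
    (horth : dz ⬝ᵥ dw = 0)
    (hres : norm2 (newtonResidual z w dz dw ((1 - σ / √(Fintype.card ι)) * 𝔼 i, z i * w i)) ≤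
      η * 𝔼 i, z i * w i) :
    norm2 (fun i => (z i + dz i) * (w i + dw i) - 𝔼 j, (z j + dz j) * (w j + dw j)) ≤
      θ * 𝔼 j, (z j + dz j) * (w j + dw j) := by
  have hμ' := (expect_step_mem_Icc horth hres).1
  set μ := 𝔼 i, z i * w i
  have hθ' : 0 < 1 - θ := sub_pos.2 hθ₁
  calc norm2 (fun i => (z i + dz i) * (w i + dw i) - 𝔼 j, (z j + dz j) * (w j + dw j))
      ≤ η * μ + norm2 (fun i => z i * dw i + w i * dz i) ^ 2 / (2 * ((1 - θ) * μ)) :=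
        (norm2_step_sub_expect_le _ (by positivity) (mul_le_of_norm2_sub_le hnear) horth).trans
          (add_le_add_left hres _)
    _ ≤ η * μ + ((√(θ ^ 2 + σ ^ 2) + η) * μ) ^ 2 / (2 * ((1 - θ) * μ)) := by
        gcongr
        · exact norm2_nonneg _
        · exact norm2_direction_le hμ.le hnear hres
    _ = (η + (√(θ ^ 2 + σ ^ 2) + η) ^ 2 / (2 * (1 - θ))) * μ := by field_simp
    _ ≤ θ * (1 - (σ + η) / √(Fintype.card ι)) * μ := by gcongr
    _ ≤ θ * 𝔼 j, (z j + dz j) * (w j + dw j) := by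
        rw [mul_assoc]
        gcongr

lemma step_pos {t μ' : ℝ} (hz : ∀ i, 0 < z i) (hw : ∀ i, 0 < w i) (hμ' : 0 < μ') (hθ₁ : θ < 1)
    (hnear : norm2 (fun i => (z i + dz i) * (w i + dw i) - μ') ≤ θ * μ')
    (hres : norm2 (newtonResidual z w dz dw t) ≤ t) (i : ι) :
    0 < z i + dz i ∧ 0 < w i + dw i := by
  refine pos_and_pos_of_mul_pos_of_cross_pos (hz i) (hw i) ?_ ?_
  · exact (mul_pos (sub_pos.2 hθ₁) hμ').trans_le (mul_le_of_norm2_sub_le hnear i)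
  · have hcross : z i * (w i + dw i) + w i * (z i + dz i) =
        z i * w i + (t + newtonResidual z w dz dw t i) := by
      simp only [newtonResidual]
      ring
    rw [hcross]
    linarith [mul_pos (hz i) (hw i), neg_le_of_abs_le ((abs_le_norm2 _ i).trans hres)]

end NewtonStep

section SkewSymmetric

variable {ι : Type} [Fintype ι] {M : Matrix ι ι ℝ}

lemma dotProduct_mulVec_eq_neg_of_skew (hM : Mᵀ = -M) (v v' : ι → ℝ) :
    v ⬝ᵥ M *ᵥ v' = -(v' ⬝ᵥ M *ᵥ v) := by
  rw [Matrix.dotProduct_mulVec, ← Matrix.mulVec_transpose, hM, Matrix.neg_mulVec,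
    neg_dotProduct, dotProduct_comm]

lemma dotProduct_mulVec_self_of_skew (hM : Mᵀ = -M) (v : ι → ℝ) : v ⬝ᵥ M *ᵥ v = 0 := by
  linarith [dotProduct_mulVec_eq_neg_of_skew hM v v]

lemma eq_zero_of_skew_of_mul_mulVec_add_mul_eq_zero (hM : Mᵀ = -M) {z w v : ι → ℝ}
    (hz : ∀ i, 0 < z i) (hw : ∀ i, 0 < w i) (h : ∀ i, z i * (M *ᵥ v) i + w i * v i = 0) :
    v = 0 := by
  have hscaled (i : ι) : z i * (v i * (M *ᵥ v) i) = -(w i * v i ^ 2) := by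
    linear_combination v i * h i
  have hnonpos (i : ι) : v i * (M *ᵥ v) i ≤ 0 := by
    refine nonpos_of_mul_nonpos_right ((hscaled i).trans_le ?_) (hz i)
    exact neg_nonpos.2 (mul_nonneg (hw i).le (sq_nonneg _))
  have hzero := (Finset.sum_eq_zero_iff_of_nonpos fun i _ => hnonpos i).1
    (dotProduct_mulVec_self_of_skew hM v)
  funext i
  have := hscaled i
  rw [hzero i (Finset.mem_univ i), mul_zero, zero_eq_neg] at this
  simpa [(hw i).ne'] using this

end SkewSymmetric

section Embedding

variable {m n : ℕ} {A : Matrix (Fin m) (Fin n) ℝ} {b : Fin m → ℝ} {c : Fin n → ℝ}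
  {Z Z' : Point m n} {θ : ℝ}

lemma card_idx (m n : ℕ) : (Fintype.card (Idx m n) : ℝ) = dim m n := by
  simp only [Fintype.card_sum, Fintype.card_fin, Fintype.card_unit, dim]
  push_cast
  ring

lemma two_le_dim (m n : ℕ) : 2 ≤ dim m n := le_add_of_nonneg_left (by positivity)

lemma dim_pos (m n : ℕ) : 0 < dim m n := two_pos.trans_le (two_le_dim m n)

lemma le_sqrt_dim (m n : ℕ) : 1.414 ≤ √(dim m n) :=
  Real.le_sqrt_of_sq_le (le_trans (by norm_num) (two_le_dim m n))

lemma sdMatrix_transpose : (sdMatrix A b c)ᵀ = -sdMatrix A b c := by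
  ext p q
  rcases p with p | p | p | p <;> rcases q with q | q | q | q <;> simp [sdMatrix]

lemma dotProduct_sdRhs (v : Idx m n → ℝ) : v ⬝ᵥ sdRhs m n = dim m n * v (iGam m n) := by
  simp [dotProduct, sdRhs, mul_comm]

lemma satisfiesEqs_ones : SatisfiesEqs A b c (ones m n) := by
  have hswap : ∑ j, ∑ i, A i j = ∑ i, ∑ j, A i j := Finset.sum_comm
  funext p
  rcases p with p | p | p | p <;>
    simp [slk, var, ones, Matrix.mulVec, dotProduct, sdMatrix, sdRhs, iGam, bBar, cBar, oBar, dim,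
      Finset.sum_add_distrib, Finset.sum_sub_distrib, Finset.sum_neg_distrib] <;>
    linarith

lemma SatisfiesEqs.slk_sub (h : SatisfiesEqs A b c Z) (h' : SatisfiesEqs A b c Z') :
    slk Z - slk Z' = sdMatrix A b c *ᵥ (var Z - var Z') := by
  rw [h, h', Matrix.mulVec_sub, add_sub_add_right_eq_sub]

lemma SatisfiesEqs.sub_dotProduct_sub (h : SatisfiesEqs A b c Z) (h' : SatisfiesEqs A b c Z') :
    (var Z - var Z') ⬝ᵥ (slk Z - slk Z') = 0 := by
  rw [h.slk_sub h', dotProduct_mulVec_self_of_skew sdMatrix_transpose]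

lemma dotProduct_eq_dim_mul_mu (Z : Point m n) : var Z ⬝ᵥ slk Z = dim m n * mu Z :=
  (mul_div_cancel₀ _ (dim_pos m n).ne').symm

lemma mu_eq_expect (Z : Point m n) : mu Z = 𝔼 i, var Z i * slk Z i := by
  rw [mu, Fintype.expect_eq_sum_div_card, card_idx]

lemma SatisfiesEqs.mu_eq (h : SatisfiesEqs A b c Z) : mu Z = var Z (iGam m n) := by
  have hgap : var Z ⬝ᵥ slk Z = dim m n * var Z (iGam m n) := by
    rw [h, dotProduct_add, dotProduct_mulVec_self_of_skew sdMatrix_transpose, zero_add,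
      dotProduct_sdRhs]
  exact mul_left_cancel₀ (dim_pos m n).ne' ((dotProduct_eq_dim_mul_mu Z).symm.trans hgap)

lemma SatisfiesEqs.sum_var_add_slk (h : SatisfiesEqs A b c Z) :
    ∑ i, (var Z i + slk Z i) = dim m n * (1 + mu Z) := by
  -- orthogonality of the difference with the all-one vector
  have horth := h.sub_dotProduct_sub satisfiesEqs_ones
  have hexpand : (var Z - var (ones m n)) ⬝ᵥ (slk Z - slk (ones m n)) =
      var Z ⬝ᵥ slk Z - ∑ i, (var Z i + slk Z i) + dim m n := by
    rw [dotProduct, dotProduct, ← Finset.sum_sub_distrib, ← card_idx, ← Finset.card_univ,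
      ← nsmul_one, ← Finset.sum_const, ← Finset.sum_add_distrib]
    refine Finset.sum_congr rfl fun i _ => ?_
    simp only [var, slk, ones, Pi.sub_apply]
    ring
  rw [hexpand, dotProduct_eq_dim_mul_mu] at horth
  linarith

lemma mu_ones : mu (ones m n) = 1 := satisfiesEqs_ones (A := 0) (b := 0) (c := 0) |>.mu_eq

lemma ones_mem_nbhd (hθ : 0 ≤ θ) : ones m n ∈ nbhd A b c θ := by
  refine ⟨⟨⟨satisfiesEqs_ones, fun _ => zero_le_one, fun _ => zero_le_one⟩,
    fun _ => zero_lt_one, fun _ => zero_lt_one⟩, ?_⟩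
  rw [mu_ones]
  simpa [norm2, var, slk, ones] using hθ

lemma mu_pos_of_mem_interiorFeasible (hZ : Z ∈ interiorFeasible A b c) : 0 < mu Z :=
  hZ.1.1.mu_eq ▸ hZ.2.1 _

lemma mul_mu_le_of_mem_nbhd (hZ : Z ∈ nbhd A b c θ) (i : Idx m n) :
    (1 - θ) * mu Z ≤ var Z i * slk Z i :=
  mul_le_of_norm2_sub_le hZ.2 i

lemma mul_le_mul_mu_of_mem_nbhd (hZ : Z ∈ nbhd A b c θ) (i : Idx m n) :
    var Z i * slk Z i ≤ (1 + θ) * mu Z := by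
  linarith [le_of_abs_le ((abs_le_norm2 (fun i => var Z i * slk Z i - mu Z) i).trans hZ.2)]

section Step

variable (Z) (lam : Idx m n → ℝ)

lemma var_step : var (Z + calV A b c *ᵥ lam) = var Z + -lam := by
  funext i
  simp [var, calV, Matrix.fromRows_mulVec, Matrix.neg_mulVec]

lemma slk_step : slk (Z + calV A b c *ᵥ lam) = slk Z + -(sdMatrix A b c *ᵥ lam) := by
  funext i
  simp [slk, calV, Matrix.fromRows_mulVec, Matrix.neg_mulVec]

lemma oss_mulVec : oss A b c Z *ᵥ lam =
    fun i => var Z i * (-(sdMatrix A b c *ᵥ lam)) i + slk Z i * (-lam) i := by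
  funext i
  simp [oss, calD, calV, Matrix.fromCols_mul_fromRows, Matrix.add_mulVec, Matrix.neg_mulVec,
    ← Matrix.mulVec_mulVec, Matrix.mulVec_diagonal]

lemma oss_mulVec_sub_calR : oss A b c Z *ᵥ lam - calR Z =
    newtonResidual (var Z) (slk Z) (-lam) (-(sdMatrix A b c *ᵥ lam)) (beta m n * mu Z) := by
  rw [oss_mulVec]
  rfl

variable {Z}

lemma SatisfiesEqs.step (h : SatisfiesEqs A b c Z) :
    SatisfiesEqs A b c (Z + calV A b c *ᵥ lam) := by
  rw [SatisfiesEqs, slk_step, var_step, Matrix.mulVec_add, Matrix.mulVec_neg, h]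
  abel

variable {lam}

lemma Accepted.residual_le (h : Accepted A b c Z lam) (hμ : 0 ≤ mu Z) :
    norm2 (oss A b c Z *ᵥ lam - calR Z) ≤ eta * mu Z := by
  rcases h with hres | ⟨lamEx, hexact, herr⟩
  · exact hres
  set op := ‖Matrix.toEuclideanCLM (𝕜 := ℝ) (oss A b c Z)‖
  calc norm2 (oss A b c Z *ᵥ lam - calR Z)
      = norm2 (oss A b c Z *ᵥ (lam - lamEx)) := by rw [← hexact, Matrix.mulVec_sub]
    _ ≤ op * norm2 (lam - lamEx) := norm2_mulVec_le _ _
    _ ≤ op * (eta * mu Z / op) := mul_le_mul_of_nonneg_left herr (norm_nonneg _)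
    _ = eta * mu Z * (op / op) := by ring
    _ ≤ eta * mu Z :=
        mul_le_of_le_one_right (mul_nonneg (by norm_num [eta]) hμ) (div_self_le_one _)

end Step

lemma exists_step (hZ : Z ∈ interiorFeasible A b c) : ∃ Z', Step A b c Z Z' := by
  have hinj : Function.Injective (oss A b c Z).mulVecLin := by
    refine LinearMap.ker_eq_bot.1 (LinearMap.ker_eq_bot'.2 fun lam h => ?_)
    refine eq_zero_of_skew_of_mul_mulVec_add_mul_eq_zero
      (sdMatrix_transpose (A := A) (b := b) (c := c)) hZ.2.1 hZ.2.2 fun i => ?_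
    have hi := congrFun h i
    rw [Matrix.mulVecLin_apply, oss_mulVec] at hi
    simp only [Pi.neg_apply, Pi.zero_apply] at hi
    linarith
  obtain ⟨lam, hlam⟩ := LinearMap.surjective_of_injective hinj (calR Z)
  refine ⟨_, lam, Or.inl ?_, rfl⟩
  rw [Matrix.mulVecLin_apply] at hlam
  rw [hlam, sub_self]
  have hμ : 0 ≤ eta * mu Z :=
    mul_nonneg (by norm_num [eta]) (mu_pos_of_mem_interiorFeasible hZ).le
  simpa [norm2] using hμ

lemma contraction_le (hθ : θ ∈ Set.Icc (2 / 10) (4 / 10)) {s : ℝ} (hs : 1.414 ≤ s) :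
    1 / 10 + (√(θ ^ 2 + (11 / 100) ^ 2) + 1 / 10) ^ 2 / (2 * (1 - θ)) ≤
      θ * (1 - (11 / 100 + 1 / 10) / s) := by
  obtain ⟨hθ₀, hθ₁⟩ := hθ
  -- an affine majorant of the convex function `√(θ² + 0.11²)` on the interval
  set g := 42 / 1000 + 9325 / 10000 * θ with hg
  have hsqrt : √(θ ^ 2 + (11 / 100) ^ 2) ≤ g :=
    Real.sqrt_le_iff.2 ⟨by positivity, by nlinarith⟩
  have hdim : (11 / 100 + 1 / 10) / s ≤ (11 / 100 + 1 / 10) / 1.414 := by gcongr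
  calc 1 / 10 + (√(θ ^ 2 + (11 / 100) ^ 2) + 1 / 10) ^ 2 / (2 * (1 - θ))
      ≤ 1 / 10 + (g + 1 / 10) ^ 2 / (2 * (1 - θ)) := by
        gcongr
        linarith
    _ ≤ θ * (1 - (11 / 100 + 1 / 10) / 1.414) := by
        rw [← le_sub_iff_add_le', div_le_iff₀ (by linarith), hg]
        nlinarith
    _ ≤ θ * (1 - (11 / 100 + 1 / 10) / s) := by gcongr

lemma Accepted.newtonResidual_le {lam : Idx m n → ℝ} (h : Accepted A b c Z lam) (hμ : 0 ≤ mu Z) :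
    norm2 (newtonResidual (var Z) (slk Z) (-lam) (-(sdMatrix A b c *ᵥ lam))
      ((1 - (11 / 100) / √(Fintype.card (Idx m n))) * 𝔼 i, var Z i * slk Z i)) ≤
      1 / 10 * 𝔼 i, var Z i * slk Z i := by
  simpa only [oss_mulVec_sub_calR, beta, eta, mu_eq_expect, card_idx] using h.residual_le hμ

lemma mu_step (Z : Point m n) (lam : Idx m n → ℝ) : mu (Z + calV A b c *ᵥ lam) =
    𝔼 i, (var Z i + (-lam) i) * (slk Z i + (-(sdMatrix A b c *ᵥ lam)) i) := by
  rw [mu_eq_expect, var_step, slk_step]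
  rfl

lemma neg_dotProduct_neg_mulVec (lam : Idx m n → ℝ) : -lam ⬝ᵥ -(sdMatrix A b c *ᵥ lam) = 0 := by
  rw [neg_dotProduct_neg, dotProduct_mulVec_self_of_skew sdMatrix_transpose]

lemma Step.mu_mem_Icc (hstep : Step A b c Z Z') (hμ : 0 ≤ mu Z) :
    mu Z' ∈ Set.Icc ((1 - (21 / 100) / √(dim m n)) * mu Z)
      ((1 - (1 / 100) / √(dim m n)) * mu Z) := by
  obtain ⟨lam, hacc, rfl⟩ := hstep
  have h := expect_step_mem_Icc (neg_dotProduct_neg_mulVec lam) (hacc.newtonResidual_le hμ)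
  rw [← mu_step, ← mu_eq_expect, card_idx] at h
  norm_num at h ⊢
  exact h

lemma Step.norm2_sub_mu_le (hstep : Step A b c Z Z') (hθ : θ ∈ Set.Icc (2 / 10) (4 / 10))
    (hZ : Z ∈ nbhd A b c θ) :
    norm2 (fun i => var Z' i * slk Z' i - mu Z') ≤ θ * mu Z' := by
  obtain ⟨lam, hacc, rfl⟩ := hstep
  have hμ := mu_pos_of_mem_interiorFeasible hZ.1
  have hnear := hZ.2
  have hres := hacc.newtonResidual_le hμ.le
  rw [mu_eq_expect] at hμ hnear
  rw [mu_step, var_step, slk_step]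
  refine norm2_step_sub_expect_le_mul hμ ?_ ?_ ?_ hnear (neg_dotProduct_neg_mulVec lam) hres
  · exact hθ.1.trans' (by norm_num)
  · exact hθ.2.trans_lt (by norm_num)
  · rw [card_idx]
    exact contraction_le hθ (le_sqrt_dim m n)

lemma div_sqrt_dim_le {a : ℝ} (ha : 0 ≤ a) : a / √(dim m n) ≤ a / 1.414 := by
  gcongr
  exact le_sqrt_dim m n

lemma eta_le_beta (m n : ℕ) : eta ≤ beta m n := by
  have := div_sqrt_dim_le (m := m) (n := n) (a := 11 / 100) (by norm_num)
  rw [eta, beta]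
  linarith

lemma Step.pos (hstep : Step A b c Z Z') (hθ : θ < 1) (hZ : Z ∈ interiorFeasible A b c)
    (hμ' : 0 < mu Z') (hnear : norm2 (fun i => var Z' i * slk Z' i - mu Z') ≤ θ * mu Z')
    (i : Idx m n) : 0 < var Z' i ∧ 0 < slk Z' i := by
  obtain ⟨lam, hacc, rfl⟩ := hstep
  have hμ := (mu_pos_of_mem_interiorFeasible hZ).le
  have hres := (hacc.residual_le hμ).trans (mul_le_mul_of_nonneg_right (eta_le_beta m n) hμ)
  rw [oss_mulVec_sub_calR] at hres
  rw [var_step, slk_step] at hnear ⊢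
  exact step_pos hZ.2.1 hZ.2.2 hμ' hθ hnear hres i

lemma Step.mem_nbhd (hstep : Step A b c Z Z') (hθ : θ ∈ Set.Icc (2 / 10) (4 / 10))
    (hZ : Z ∈ nbhd A b c θ) : Z' ∈ nbhd A b c θ := by
  have hμ := mu_pos_of_mem_interiorFeasible hZ.1
  have hμ' : 0 < mu Z' := by
    refine (mul_pos ?_ hμ).trans_le (hstep.mu_mem_Icc hμ.le).1
    have := div_sqrt_dim_le (m := m) (n := n) (a := 21 / 100) (by norm_num)
    linarith
  have hnear := hstep.norm2_sub_mu_le hθ hZ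
  have hpos := hstep.pos (hθ.2.trans_lt (by norm_num)) hZ.1 hμ' hnear
  have heqs : SatisfiesEqs A b c Z' := by
    obtain ⟨lam, -, rfl⟩ := hstep
    exact hZ.1.1.1.step lam
  exact ⟨⟨⟨heqs, fun i => (hpos i).1.le, fun i => (hpos i).2.le⟩, fun i => (hpos i).1,
    fun i => (hpos i).2⟩, hnear⟩

section Run

variable {X : ℕ → Point m n}

lemma IsRun.mem_nbhd (hX : IsRun A b c θ X) (hθ : θ ∈ Set.Icc (2 / 10) (4 / 10)) (k : ℕ) :
    X k ∈ nbhd A b c θ := by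
  induction k with
  | zero => exact hX.1
  | succ k ih => exact (hX.2 k).mem_nbhd hθ ih

lemma IsRun.mu_pos (hX : IsRun A b c θ X) (hθ : θ ∈ Set.Icc (2 / 10) (4 / 10)) (k : ℕ) :
    0 < mu (X k) :=
  mu_pos_of_mem_interiorFeasible (hX.mem_nbhd hθ k).1

lemma IsRun.mu_succ_le (hX : IsRun A b c θ X) (hθ : θ ∈ Set.Icc (2 / 10) (4 / 10)) (k : ℕ) :
    mu (X (k + 1)) ≤ (1 - (1 / 100) / √(dim m n)) * mu (X k) :=
  ((hX.2 k).mu_mem_Icc (hX.mu_pos hθ k).le).2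

lemma rate_mem_Ico (m n : ℕ) : 1 - (1 / 100) / √(dim m n) ∈ Set.Ico (0 : ℝ) 1 := by
  have hle := div_sqrt_dim_le (m := m) (n := n) (a := 1 / 100) (by norm_num)
  have hpos : 0 < (1 / 100) / √(dim m n) := div_pos (by norm_num) (Real.sqrt_pos.2 (dim_pos m n))
  constructor <;> linarith

lemma IsRun.mu_le_pow (hX : IsRun A b c θ X) (hθ : θ ∈ Set.Icc (2 / 10) (4 / 10)) (k : ℕ) :
    mu (X k) ≤ (1 - (1 / 100) / √(dim m n)) ^ k * mu (X 0) := by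
  induction k with
  | zero => simp
  | succ k ih =>
    refine (hX.mu_succ_le hθ k).trans ?_
    rw [pow_succ', mul_assoc]
    exact mul_le_mul_of_nonneg_left ih (rate_mem_Ico m n).1

lemma IsRun.tendsto_mu (hX : IsRun A b c θ X) (hθ : θ ∈ Set.Icc (2 / 10) (4 / 10)) :
    Tendsto (fun k => mu (X k)) atTop (𝓝 0) := by
  have hpow := (tendsto_pow_atTop_nhds_zero_of_lt_one (rate_mem_Ico m n).1
    (rate_mem_Ico m n).2).mul_const (mu (X 0))
  rw [zero_mul] at hpow
  exact squeeze_zero (fun k => (hX.mu_pos hθ k).le) (hX.mu_le_pow hθ) hpow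

lemma IsRun.mu_le_exp (hX : IsRun A b c θ X) (hθ : θ ∈ Set.Icc (2 / 10) (4 / 10)) {k : ℕ}
    {t : ℝ} (hk : 100 * √(dim m n) * t ≤ k) : mu (X k) ≤ Real.exp (-t) * mu (X 0) := by
  have hs : 0 < √(dim m n) := Real.sqrt_pos.2 (dim_pos m n)
  refine (hX.mu_le_pow hθ k).trans (mul_le_mul_of_nonneg_right ?_ (hX.mu_pos hθ 0).le)
  calc (1 - (1 / 100) / √(dim m n)) ^ k
      ≤ Real.exp (-((1 / 100) / √(dim m n))) ^ k :=
        pow_le_pow_left₀ (rate_mem_Ico m n).1 (Real.one_sub_le_exp_neg _) k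
    _ = Real.exp (-(k * ((1 / 100) / √(dim m n)))) := by rw [← Real.exp_nat_mul, mul_neg]
    _ ≤ Real.exp (-t) := by
        refine Real.exp_le_exp.2 (neg_le_neg ?_)
        rw [← mul_div_assoc, le_div_iff₀ hs]
        linarith

lemma pos_of_add_add_two_le_mul {κ : ℝ} (hκ : (n : ℝ) + m + 2 ≤ κ * n) : 0 < n := by
  refine Nat.pos_of_ne_zero fun hn => ?_
  rw [hn, Nat.cast_zero, mul_zero] at hκ
  linarith [m.cast_nonneg (α := ℝ)]

lemma mul_sqrt_dim_mul_le {κ a D t : ℝ} {k : ℕ} (hκ : (n : ℝ) + m + 2 ≤ κ * n) (ha : 0 ≤ a)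
    (haD : a ≤ D) (hk : D * √κ * √n * t ≤ k) : a * √(dim m n) * t ≤ k := by
  rcases le_total t 0 with ht | ht
  · exact (mul_nonpos_of_nonneg_of_nonpos (by positivity) ht).trans k.cast_nonneg
  · have hdim : √(dim m n) ≤ √κ * √n := by
      rw [← Real.sqrt_mul' _ n.cast_nonneg]
      exact Real.sqrt_le_sqrt hκ
    calc a * √(dim m n) * t ≤ D * (√κ * √n) * t := by gcongr; exact ha.trans haD
      _ ≤ k := by rwa [← mul_assoc]

lemma IsRun.mem_zetaOptimal (hX : IsRun A b c θ X) (hθ : θ ∈ Set.Icc (2 / 10) (4 / 10)) {k : ℕ}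
    {μ₀ ζ : ℝ} (hζ : 0 < ζ) (hμ₀ : mu (X 0) ≤ μ₀)
    (hk : 100 * √(dim m n) * Real.log (μ₀ / ζ) ≤ k) : X k ∈ zetaOptimal A b c ζ := by
  have hpos : 0 < μ₀ := (hX.mu_pos hθ 0).trans_le hμ₀
  refine ⟨(hX.mem_nbhd hθ k).1.1, ?_⟩
  calc mu (X k) ≤ Real.exp (-Real.log (μ₀ / ζ)) * mu (X 0) := hX.mu_le_exp hθ hk
    _ = ζ / μ₀ * mu (X 0) := by rw [Real.exp_neg, Real.exp_log (div_pos hpos hζ), inv_div]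
    _ ≤ ζ / μ₀ * μ₀ := by gcongr
    _ = ζ := div_mul_cancel₀ ζ hpos.ne'

end Run

end Embedding

section StrictComplementarity

variable {α : Type} {l : Filter α} {b : ℝ} {μ : α → ℝ}

lemma tendsto_sub_mul_div_zero {f g : α → ℝ} {a : ℝ} (ha : a ≠ 0) (hlim : Tendsto f l (𝓝 a))
    (hf : ∀ k, 0 < f k) (hg : ∀ k, 0 ≤ g k) (hμ : ∀ k, 0 < μ k) (hb : ∀ k, f k * g k ≤ b * μ k) :
    Tendsto (fun k => (f k - a) * g k / μ k) l (𝓝 0) := by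
  have hquot : Tendsto (fun k => |1 - a / f k| * b) l (𝓝 0) := by
    have h := (((tendsto_const_nhds (x := a)).div hlim ha).const_sub 1).abs.mul_const b
    rwa [div_self ha, sub_self, abs_zero, zero_mul] at h
  refine squeeze_zero_norm (fun k => ?_) hquot
  have hfactor : (f k - a) * g k / μ k = (1 - a / f k) * (f k * g k / μ k) := by
    have := (hf k).ne'
    field_simp
  rw [hfactor, Real.norm_eq_abs, abs_mul,
    abs_of_nonneg (div_nonneg (mul_nonneg (hf k).le (hg k)) (hμ k).le)]
  exact mul_le_mul_of_nonneg_left ((div_le_iff₀ (hμ k)).2 (hb k)) (abs_nonneg _)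

lemma tendsto_min_cross_div_zero {f g : α → ℝ} {f' g' : ℝ} (hf : ∀ k, 0 < f k)
    (hg : ∀ k, 0 < g k) (hμ : ∀ k, 0 < μ k) (hb : ∀ k, f k * g k ≤ b * μ k)
    (hflim : Tendsto f l (𝓝 f')) (hglim : Tendsto g l (𝓝 g')) (hcompl : f' * g' = 0) :
    Tendsto (fun k => min ((f k * g k - (f' * g k + g' * f k)) / μ k) 0) l (𝓝 0) := by
  have of_tendsto {d : α → ℝ} (h : Tendsto d l (𝓝 0)) :
      Tendsto (fun k => min (d k) 0) l (𝓝 0) := by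
    simpa only [min_self] using h.min (tendsto_const_nhds (x := (0 : ℝ)))
  by_cases hf' : f' = 0
  · by_cases hg' : g' = 0
    · refine tendsto_const_nhds.congr fun k => (min_eq_right ?_).symm
      rw [hf', hg', zero_mul, zero_mul, add_zero, sub_zero]
      exact div_nonneg (mul_nonneg (hf k).le (hg k).le) (hμ k).le
    · refine of_tendsto ((tendsto_sub_mul_div_zero hg' hglim hg (fun k => (hf k).le) hμ
        fun k => (mul_comm _ _).trans_le (hb k)).congr fun k => ?_)
      rw [hf']
      ring
  · have hg' : g' = 0 := (mul_eq_zero.1 hcompl).resolve_left hf'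
    refine of_tendsto ((tendsto_sub_mul_div_zero hf' hflim hf (fun k => (hg k).le) hμ
      hb).congr fun k => ?_)
    rw [hg']
    ring

lemma add_pos_of_tendsto_of_cross_sum_eq {ι : Type} [Fintype ι] [l.NeBot]
    {z w : α → ι → ℝ} {z' w' : ι → ℝ} {a : ℝ} (ha : 0 < a)
    (hz : ∀ k i, 0 < z k i) (hw : ∀ k i, 0 < w k i) (hμ : ∀ k, 0 < μ k)
    (hlow : ∀ k i, a * μ k ≤ z k i * w k i) (hup : ∀ k i, z k i * w k i ≤ b * μ k)
    (hzlim : Tendsto z l (𝓝 z')) (hwlim : Tendsto w l (𝓝 w'))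
    (hz' : ∀ i, 0 ≤ z' i) (hw' : ∀ i, 0 ≤ w' i) (hcompl : ∀ i, z' i * w' i = 0)
    (hcross : ∀ k, ∑ i, (z' i * w k i + w' i * z k i) = ∑ i, z k i * w k i) (i : ι) :
    0 < z' i + w' i := by
  classical
  -- the terms of the cross identity, divided by `μ`, sum to zero and are asymptotically
  -- nonnegative; a coordinate with `z' = w' = 0` would contribute at least `a`
  set d : α → ι → ℝ := fun k j => (z k j * w k j - (z' j * w k j + w' j * z k j)) / μ k with hd
  by_contra hi
  have hi₁ : z' i = 0 := by linarith [hz' i, hw' i]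
  have hi₂ : w' i = 0 := by linarith [hz' i, hw' i]
  have hdi (k : α) : a ≤ d k i := by
    simp only [hd, hi₁, hi₂, zero_mul, add_zero, sub_zero]
    exact (le_div_iff₀ (hμ k)).2 (hlow k i)
  have hbound (k : α) : ∑ j, min (d k j) 0 ≤ -a := by
    have hdsum : ∑ j, d k j = 0 := by
      rw [← Finset.sum_div, Finset.sum_sub_distrib, hcross, sub_self, zero_div]
    have hle : ∑ j ∈ Finset.univ.erase i, min (d k j) 0 ≤ ∑ j ∈ Finset.univ.erase i, d k j :=
      Finset.sum_le_sum fun j _ => min_le_left _ _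
    have hsplit := Finset.add_sum_erase Finset.univ (d k) (Finset.mem_univ i)
    rw [← Finset.add_sum_erase _ _ (Finset.mem_univ i), min_eq_right (ha.le.trans (hdi k))]
    linarith [hdi k]
  have hlim := tendsto_finsetSum Finset.univ fun j (_ : j ∈ Finset.univ) =>
    tendsto_min_cross_div_zero (fun k => hz k j) (fun k => hw k j) hμ (fun k => hup k j)
      (tendsto_pi_nhds.1 hzlim j) (tendsto_pi_nhds.1 hwlim j) (hcompl j)
  rw [Finset.sum_const_zero] at hlim
  linarith [le_of_tendsto' hlim hbound]

end StrictComplementarity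

section Embedding

variable {m n : ℕ} {A : Matrix (Fin m) (Fin n) ℝ} {b : Fin m → ℝ} {c : Fin n → ℝ}
  {Z Z' P : Point m n} {θ : ℝ}

lemma IsStrictOptimal.mu_eq_zero (hZ : IsStrictOptimal A b c Z) : mu Z = 0 := by
  rw [mu, Finset.sum_eq_zero fun i _ => (hZ.2.2 i).1, zero_div]

lemma mul_eq_zero_of_mem_feasible (hP : P ∈ feasible A b c) (hμ : mu P = 0) (i : Idx m n) :
    var P i * slk P i = 0 := by
  have hsum := dotProduct_eq_dim_mul_mu P
  rw [hμ, mul_zero] at hsum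
  exact (Finset.sum_eq_zero_iff_of_nonneg fun i _ => mul_nonneg (hP.2.1 i) (hP.2.2 i)).1 hsum i
    (Finset.mem_univ i)

lemma isStrictOptimal_of_mu_eq_zero (hP : P ∈ feasible A b c) (hμ : mu P = 0)
    (hpos : ∀ i, 0 < var P i + slk P i) : IsStrictOptimal A b c P := by
  refine ⟨hP, fun Q hQ => ?_, fun i => ⟨mul_eq_zero_of_mem_feasible hP hμ i, hpos i⟩⟩
  rw [← hP.1.mu_eq, hμ]
  exact mul_le_mul_of_nonneg_left (hQ.2.1 _) (dim_pos m n).le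

lemma isClosed_satisfiesEqs : IsClosed {Z : Point m n | SatisfiesEqs A b c Z} := by
  refine isClosed_eq ?_ (Continuous.add ?_ continuous_const)
  · exact continuous_pi fun i => continuous_apply _
  · exact continuous_const.matrix_mulVec (continuous_pi fun i => continuous_apply _)

lemma SatisfiesEqs.cross_sum_eq (h : SatisfiesEqs A b c Z) (h' : SatisfiesEqs A b c Z')
    (hμ : mu Z' = 0) :
    ∑ i, (var Z' i * slk Z i + slk Z' i * var Z i) = ∑ i, var Z i * slk Z i := by
  have horth := h.sub_dotProduct_sub h'
  have hgap := dotProduct_eq_dim_mul_mu Z'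
  rw [hμ, mul_zero] at hgap
  have hcomm : ∑ i, slk Z' i * var Z i = var Z ⬝ᵥ slk Z' := dotProduct_comm _ _
  rw [sub_dotProduct, dotProduct_sub, dotProduct_sub, hgap] at horth
  rw [Finset.sum_add_distrib, hcomm]
  simp only [dotProduct] at horth ⊢
  linarith

lemma nonneg_of_mem_feasible (hZ : Z ∈ feasible A b c) : 0 ≤ Z :=
  fun p => p.casesOn hZ.2.2 hZ.2.1

lemma apply_mem_Icc_of_mem_feasible (hZ : Z ∈ feasible A b c) (p : Idx m n ⊕ Idx m n) :
    Z p ∈ Set.Icc 0 (dim m n * (1 + mu Z)) := by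
  have hnonneg := nonneg_of_mem_feasible hZ
  have hsum : ∑ q, Z q = dim m n * (1 + mu Z) := by
    rw [Fintype.sum_sum_type, add_comm, ← Finset.sum_add_distrib]
    exact hZ.1.sum_var_add_slk
  exact ⟨hnonneg p, hsum ▸ Finset.single_le_sum (fun q _ => hnonneg q) (Finset.mem_univ p)⟩

lemma exists_isStrictOptimal {X : ℕ → Point m n} (hX : ∀ k, X k ∈ nbhd A b c θ) (hθ : θ < 1)
    (hμ : Tendsto (fun k => mu (X k)) atTop (𝓝 0)) : ∃ Z, IsStrictOptimal A b c Z := by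
  have hfeas (k : ℕ) : X k ∈ feasible A b c := (hX k).1.1
  obtain ⟨μ₀, hμ₀⟩ := hμ.bddAbove_range
  have hbox (k : ℕ) : X k ∈ Set.Icc 0 (fun _ => dim m n * (1 + μ₀)) := by
    have hle := hμ₀ (Set.mem_range_self k)
    refine ⟨fun p => (apply_mem_Icc_of_mem_feasible (hfeas k) p).1, fun p => ?_⟩
    refine (apply_mem_Icc_of_mem_feasible (hfeas k) p).2.trans ?_
    exact mul_le_mul_of_nonneg_left (add_le_add_right hle 1) (dim_pos m n).le
  obtain ⟨Z, -, φ, hφ, hlim⟩ := isCompact_Icc.tendsto_subseq hbox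
  have hlimvar : Tendsto (fun k => var (X (φ k))) atTop (𝓝 (var Z)) :=
    tendsto_pi_nhds.2 fun i => tendsto_pi_nhds.1 hlim (Sum.inr i)
  have hlimslk : Tendsto (fun k => slk (X (φ k))) atTop (𝓝 (slk Z)) :=
    tendsto_pi_nhds.2 fun i => tendsto_pi_nhds.1 hlim (Sum.inl i)
  have hZ : Z ∈ feasible A b c :=
    ⟨isClosed_satisfiesEqs.mem_of_tendsto hlim (Eventually.of_forall fun k => (hfeas (φ k)).1),
      fun i => ge_of_tendsto' (tendsto_pi_nhds.1 hlimvar i) fun k => (hfeas (φ k)).2.1 i,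
      fun i => ge_of_tendsto' (tendsto_pi_nhds.1 hlimslk i) fun k => (hfeas (φ k)).2.2 i⟩
  have hμZ : mu Z = 0 := by
    rw [hZ.1.mu_eq]
    exact tendsto_nhds_unique (tendsto_pi_nhds.1 hlimvar _)
      ((hμ.comp hφ.tendsto_atTop).congr fun k => (hfeas (φ k)).1.mu_eq)
  refine ⟨Z, isStrictOptimal_of_mu_eq_zero hZ hμZ fun i => ?_⟩
  exact add_pos_of_tendsto_of_cross_sum_eq (sub_pos.2 hθ)
    (fun k => (hX (φ k)).1.2.1) (fun k => (hX (φ k)).1.2.2)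
    (fun k => mu_pos_of_mem_interiorFeasible (hX (φ k)).1)
    (fun k => mul_mu_le_of_mem_nbhd (hX (φ k))) (fun k => mul_le_mul_mu_of_mem_nbhd (hX (φ k)))
    hlimvar hlimslk hZ.2.1 hZ.2.2 (mul_eq_zero_of_mem_feasible hZ hμZ)
    (fun k => (hfeas (φ k)).1.cross_sum_eq hZ.1 hμZ) i

end Embedding

section Support

variable {𝕜 α : Type*} [Field 𝕜] {x v : α → 𝕜}

lemma support_add_smul_ssubset (hvx : v.support ⊆ x.support) {c : α} {t : 𝕜}
    (hc : x c ≠ 0) (ht : x c + t * v c = 0) : (x + t • v).support ⊂ x.support := by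
  refine (Set.ssubset_iff_of_subset fun d hd hxd => ?_).2 ⟨c, hc, fun h => h ht⟩
  refine hd (?_ : x d + t * v d = 0)
  have hvd : v d = 0 := Function.notMem_support.1 fun h => hvx h hxd
  rw [hxd, hvd, mul_zero, add_zero]

lemma exists_nonneg_add_smul_support_ssubset [LinearOrder 𝕜] [IsStrictOrderedRing 𝕜]
    [Finite α] (hx : 0 ≤ x) (hvx : v.support ⊆ x.support) (hv : ¬0 ≤ v) :
    ∃ t : 𝕜, 0 ≤ t ∧ 0 ≤ x + t • v ∧ (x + t • v).support ⊂ x.support := by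
  cases nonempty_fintype α
  obtain ⟨c', hc'⟩ : ∃ c, v c < 0 := by
    simpa only [Pi.le_def, Pi.zero_apply, not_forall, not_le] using hv
  -- the ratio test of the simplex method
  obtain ⟨c, hc, hmin⟩ := (Finset.univ.filter fun c => v c < 0).exists_min_image
    (fun c => x c / -v c) ⟨c', Finset.mem_filter.2 ⟨Finset.mem_univ _, hc'⟩⟩
  simp only [Finset.mem_filter, Finset.mem_univ, true_and] at hc hmin
  have ht : 0 ≤ x c / -v c := div_nonneg (hx c) (neg_pos.2 hc).le
  refine ⟨x c / -v c, ht, fun d => ?_, support_add_smul_ssubset hvx (hvx hc.ne) ?_⟩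
  · simp only [Pi.zero_apply, Pi.add_apply, Pi.smul_apply, smul_eq_mul]
    rcases lt_or_ge (v d) 0 with hd | hd
    · linarith [(le_div_iff₀ (neg_pos.2 hd)).1 (hmin d hd)]
    · exact add_nonneg (hx d) (mul_nonneg ht hd)
  · linarith [div_mul_cancel₀ (x c) (neg_pos.2 hc).ne']

end Support

section BasicSolution

variable {𝕜 R C : Type*} [Field 𝕜] [Fintype C] {G : Matrix R C 𝕜} {x : C → 𝕜}

lemma submatrix_mulVec_of_support {κ : Type*} (G : Matrix R C 𝕜) (f : κ → R) (x : C → 𝕜)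
    [Fintype x.support] :
    G.submatrix f (Subtype.val : x.support → C) *ᵥ (fun c => x c) = fun i => (G *ᵥ x) (f i) := by
  funext i
  refine Fintype.sum_of_injective Subtype.val Subtype.val_injective _ _ (fun c hc => ?_)
    fun _ => rfl
  rw [Subtype.range_coe] at hc
  rw [Function.notMem_support.1 hc, mul_zero]

lemma exists_mulVec_eq_zero_of_not_linearIndepOn {s : Set C} (h : ¬LinearIndepOn 𝕜 G.col s) :
    ∃ v : C → 𝕜, v ≠ 0 ∧ v.support ⊆ s ∧ G *ᵥ v = 0 := by
  obtain ⟨v, hvs, hGv, hv⟩ := linearDepOn_iff'.1 h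
  refine ⟨v, fun h => hv (DFunLike.coe_injective h), ?_, ?_⟩
  · rw [Finsupp.fun_support_eq]
    exact (Finsupp.mem_supported 𝕜 v).1 hvs
  · rw [← hGv, Finsupp.linearCombination_apply,
      Finsupp.sum_fintype v _ fun c => zero_smul 𝕜 (G.col c),
      Matrix.mulVec_eq_sum]
    exact Finset.sum_congr rfl fun c _ => op_smul_eq_smul _ _

lemma exists_basic_solution (G : Matrix R C 𝕜) (x : C → 𝕜) :
    ∃ d : C → 𝕜, d.support ⊆ x.support ∧ G *ᵥ d = G *ᵥ x ∧ LinearIndepOn 𝕜 G.col d.support := by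
  induction hk : x.support.ncard using Nat.strong_induction_on generalizing x with
  | _ k ih =>
  by_cases hli : LinearIndepOn 𝕜 G.col x.support
  · exact ⟨x, subset_rfl, rfl, hli⟩
  obtain ⟨v, hv, hvx, hGv⟩ := exists_mulVec_eq_zero_of_not_linearIndepOn hli
  obtain ⟨c, hc⟩ := Function.ne_iff.1 hv
  have hlt : (x + (-(x c / v c)) • v).support ⊂ x.support :=
    support_add_smul_ssubset hvx (hvx hc) (by field_simp [show v c ≠ 0 from hc]; ring)
  obtain ⟨d, hdx, hGd, hd⟩ := ih _ (hk ▸ Set.ncard_lt_ncard hlt) _ rfl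
  refine ⟨d, hdx.trans hlt.subset, ?_, hd⟩
  rw [hGd, Matrix.mulVec_add, Matrix.mulVec_smul, hGv, smul_zero, add_zero]

lemma exists_nonneg_basic_solution [LinearOrder 𝕜] [IsStrictOrderedRing 𝕜] (hx : 0 ≤ x)
    (hrec : ∀ v : C → 𝕜, v.support ⊆ x.support → 0 ≤ v → G *ᵥ v = 0 → v = 0) {c : C}
    (hc : 0 < x c) :
    ∃ d : C → 𝕜, 0 ≤ d ∧ d.support ⊆ x.support ∧ G *ᵥ d = G *ᵥ x ∧
      LinearIndepOn 𝕜 G.col d.support ∧ 0 < d c := by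
  induction hk : x.support.ncard using Nat.strong_induction_on generalizing x with
  | _ k ih =>
  by_cases hli : LinearIndepOn 𝕜 G.col x.support
  · exact ⟨x, hx, subset_rfl, rfl, hli, hc⟩
  obtain ⟨v, hv, hvx, hGv⟩ := exists_mulVec_eq_zero_of_not_linearIndepOn hli
  -- the coordinate at `c` must not decrease along `v`
  wlog hvc : 0 ≤ v c generalizing v
  · exact this (-v) (neg_ne_zero.2 hv) (by rwa [Function.support_neg])
      (by rw [Matrix.mulVec_neg, hGv, neg_zero]) (neg_nonneg.2 (le_of_not_ge hvc))
  obtain ⟨t, ht, hnonneg, hlt⟩ := exists_nonneg_add_smul_support_ssubset hx hvx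
    fun h => hv (hrec v hvx h hGv)
  obtain ⟨d, hd, hdx, hGd, hdli, hdc⟩ := ih _ (hk ▸ Set.ncard_lt_ncard hlt) hnonneg
    (fun v hv => hrec v (hv.trans hlt.subset)) (add_pos_of_pos_of_nonneg hc (mul_nonneg ht hvc)) rfl
  refine ⟨d, hd, hdx.trans hlt.subset, ?_, hdli, hdc⟩
  rw [hGd, Matrix.mulVec_add, Matrix.mulVec_smul, hGv, smul_zero, add_zero]

end BasicSolution

section IntegralSystem

variable {𝕜 R C J : Type*} [Field 𝕜] [Fintype C] [Fintype J]

lemma abs_det_le_prod_sum_abs [DecidableEq J] (B : Matrix J J ℝ) :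
    |B.det| ≤ ∏ i, ∑ j, |B i j| := by
  rw [Finset.prod_univ_sum, ← Matrix.det_transpose, Matrix.det_apply]
  calc |∑ σ : Equiv.Perm J, Equiv.Perm.sign σ • ∏ i, Bᵀ (σ i) i|
      ≤ ∑ σ : Equiv.Perm J, ∏ i, |B i (σ i)| := by
        refine (Finset.abs_sum_le_sum_abs _ _).trans (Finset.sum_le_sum fun σ _ => ?_)
        rw [Units.smul_def, zsmul_eq_mul, abs_mul, Finset.abs_prod, ← Int.cast_abs,
          Int.abs_eq_natAbs, Int.units_natAbs]
        simp only [Nat.cast_one, Int.cast_one, one_mul, Matrix.transpose_apply, le_refl]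
    _ = ∑ φ ∈ Finset.univ.image (fun σ : Equiv.Perm J => (σ : J → J)), ∏ i, |B i (φ i)| := by
        rw [Finset.sum_image fun σ _ τ _ h => Equiv.ext (congrFun h)]
    _ ≤ ∑ φ ∈ Fintype.piFinset fun _ => Finset.univ, ∏ i, |B i (φ i)| :=
        Finset.sum_le_sum_of_subset_of_nonneg (fun φ _ => by simp)
          fun _ _ _ => Finset.prod_nonneg fun _ _ => abs_nonneg _

lemma one_le_abs_of_mem_intRange {t : ℝ} (ht : t ∈ (Int.castRingHom ℝ).range) (h : t ≠ 0) :
    1 ≤ |t| := by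
  obtain ⟨k, rfl⟩ := ht
  rw [eq_intCast] at h ⊢
  exact_mod_cast Int.one_le_abs (Int.cast_ne_zero.1 h)

lemma det_mem_of_forall_mem {S : Type*} [CommRing S] {s : Subring S} [DecidableEq J]
    {B : Matrix J J S} (hB : ∀ i j, B i j ∈ s) : B.det ∈ s := by
  rw [Matrix.det_apply]
  exact sum_mem fun σ _ => zsmul_mem (prod_mem fun i _ => hB _ _) _

lemma exists_submatrix_det_ne_zero [Finite R] [DecidableEq J] {B : Matrix R J 𝕜}
    (hB : LinearIndependent 𝕜 B.col) :
    ∃ f : J → R, Function.Injective f ∧ (B.submatrix f id).det ≠ 0 := by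
  cases nonempty_fintype R
  obtain ⟨κ, a, ha, hspan, hli⟩ := exists_linearIndependent' 𝕜 B.row
  have : Fintype κ := Fintype.ofInjective a ha
  have hcard : Fintype.card κ = Fintype.card J := by
    rw [← finrank_span_eq_card hli, hspan, ← Matrix.rank_eq_finrank_span_row,
      Matrix.rank_eq_finrank_span_cols, finrank_span_eq_card hB]
  let e : J ≃ κ := (Fintype.equivOfCardEq hcard).symm
  have hrow : LinearIndependent 𝕜 (B.submatrix (a ∘ e) id).row := hli.comp e e.injective
  rw [Matrix.linearIndependent_rows_iff_isUnit, Matrix.isUnit_iff_isUnit_det] at hrow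
  exact ⟨a ∘ e, ha.comp e.injective, hrow.ne_zero⟩

lemma exists_det_mul_eq_cramer [Finite R] {G : Matrix R C 𝕜} {x : C → 𝕜}
    [DecidableEq C] [Fintype x.support] (hx : LinearIndepOn 𝕜 G.col x.support) :
    ∃ f : x.support → R, Function.Injective f ∧ (G.submatrix f Subtype.val).det ≠ 0 ∧
      ∀ c : x.support, (G.submatrix f Subtype.val).det * x c =
        (G.submatrix f Subtype.val).cramer (fun i => (G *ᵥ x) (f i)) c := by
  obtain ⟨f, hf, hdet⟩ := exists_submatrix_det_ne_zero (B := G.submatrix id Subtype.val) hx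
  refine ⟨f, hf, hdet, fun c => ?_⟩
  rw [← submatrix_mulVec_of_support, Matrix.cramer_eq_adjugate_mulVec, Matrix.mulVec_mulVec,
    Matrix.adjugate_mul, Matrix.smul_mulVec, Matrix.one_mulVec, Pi.smul_apply, smul_eq_mul]

lemma one_le_one_add_sum_abs (G : Matrix R C ℝ) (r : R) : 1 ≤ 1 + ∑ c, |G r c| :=
  le_add_of_nonneg_right (Finset.sum_nonneg fun _ _ => abs_nonneg _)

lemma sum_abs_comp_le (G : Matrix R C ℝ) {a : J → C} (ha : Function.Injective a) (r : R) :
    ∑ j, |G r (a j)| ≤ ∑ c, |G r c| := by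
  classical
  rw [← Finset.sum_image (s := Finset.univ) (f := fun c => |G r c|) (g := a) ha.injOn]
  exact Finset.sum_le_sum_of_subset_of_nonneg (Finset.subset_univ _) fun _ _ _ => abs_nonneg _

variable [Fintype R]

/-- The product of the row sums of `|G|`, each increased by one. It bounds all minors of `G`, and
the extra unit leaves room for a right-hand side with entries in `[-1, 1]` to replace a column, as
Cramer's rule requires. -/
def minorBound (G : Matrix R C ℝ) : ℝ := ∏ r, (1 + ∑ c, |G r c|)

variable {G : Matrix R C ℝ} {x z : C → ℝ} {ε δ : ℝ}

lemma prod_comp_le_minorBound (G : Matrix R C ℝ) {f : J → R} (hf : Function.Injective f) :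
    ∏ j, (1 + ∑ c, |G (f j) c|) ≤ minorBound G := by
  classical
  rw [← Finset.prod_image (s := Finset.univ) (f := fun r => 1 + ∑ c, |G r c|) (g := f) hf.injOn]
  exact Finset.prod_le_prod_of_subset_of_one_le (Finset.subset_univ _)
    (fun r _ => zero_le_one.trans (one_le_one_add_sum_abs G r))
    fun r _ _ => one_le_one_add_sum_abs G r

lemma one_add_sum_abs_le_minorBound (G : Matrix R C ℝ) (r : R) :
    1 + ∑ c, |G r c| ≤ minorBound G := by
  simpa only [Fintype.prod_unique] using
    prod_comp_le_minorBound G (f := fun _ : Unit => r) (Function.injective_of_subsingleton _)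

lemma one_le_minorBound (G : Matrix R C ℝ) : 1 ≤ minorBound G := by
  simpa only [Fintype.prod_empty] using
    prod_comp_le_minorBound G (f := Empty.elim) (Function.injective_of_subsingleton _)

lemma abs_det_le_minorBound [DecidableEq J] {B : Matrix J J ℝ} {f : J → R}
    (hf : Function.Injective f) (h : ∀ j, ∑ k, |B j k| ≤ 1 + ∑ c, |G (f j) c|) :
    |B.det| ≤ minorBound G :=
  (abs_det_le_prod_sum_abs B).trans <| (Finset.prod_le_prod
    (fun _ _ => Finset.sum_nonneg fun _ _ => abs_nonneg _) fun j _ => h j).trans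
    (prod_comp_le_minorBound G hf)

lemma abs_det_submatrix_le_minorBound (G : Matrix R C ℝ) [DecidableEq J] {f : J → R} {a : J → C}
    (hf : Function.Injective f) (ha : Function.Injective a) :
    |(G.submatrix f a).det| ≤ minorBound G :=
  abs_det_le_minorBound hf fun j =>
    (sum_abs_comp_le G ha (f j)).trans (le_add_of_nonneg_left zero_le_one)

lemma abs_cramer_submatrix_le_minorBound (G : Matrix R C ℝ) [DecidableEq J] {f : J → R}
    {a : J → C} (hf : Function.Injective f) (ha : Function.Injective a) {h : J → ℝ}
    (hh : ∀ i, |h i| ≤ 1) (j : J) : |(G.submatrix f a).cramer h j| ≤ minorBound G := by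
  rw [Matrix.cramer_apply]
  refine abs_det_le_minorBound hf fun i => ?_
  calc ∑ k, |(G.submatrix f a).updateCol j h i k|
      ≤ ∑ k, ((if k = j then 1 else 0) + |G (f i) (a k)|) := by
        refine Finset.sum_le_sum fun k _ => ?_
        rw [Matrix.updateCol_apply]
        split_ifs
        · exact (hh i).trans (le_add_of_nonneg_right (abs_nonneg _))
        · rw [zero_add, Matrix.submatrix_apply]
    _ = 1 + ∑ k, |G (f i) (a k)| := by
        rw [Finset.sum_add_distrib, Finset.sum_ite_eq' Finset.univ j, if_pos (Finset.mem_univ j)]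
    _ ≤ 1 + ∑ c, |G (f i) c| := by grw [sum_abs_comp_le G ha (f i)]

lemma abs_le_of_linearIndepOn_support (hG : ∀ r c, G r c ∈ (Int.castRingHom ℝ).range)
    (hx : LinearIndepOn ℝ G.col x.support) (hε : 0 < ε) (h : ∀ r, |(G *ᵥ x) r| ≤ ε) (c : C) :
    |x c| ≤ minorBound G * ε := by
  classical
  have hΔε : 0 ≤ minorBound G * ε :=
    mul_nonneg (zero_le_one.trans (one_le_minorBound G)) hε.le
  by_cases hc : x c = 0
  · rwa [hc, abs_zero]
  obtain ⟨f, hf, hdet, hcramer⟩ := exists_det_mul_eq_cramer hx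
  set B := G.submatrix f Subtype.val
  set g : x.support → ℝ := fun i => (G *ᵥ x) (f i) / ε with hg
  have hscale : (fun i => (G *ᵥ x) (f i)) = ε • g := by
    funext i
    rw [Pi.smul_apply, smul_eq_mul, mul_div_cancel₀ _ hε.ne']
  have hg_le (i : x.support) : |g i| ≤ 1 := by
    rw [hg, abs_div, abs_of_pos hε, div_le_one hε]
    exact h _
  have hdet_le : 1 ≤ |B.det| :=
    one_le_abs_of_mem_intRange (det_mem_of_forall_mem fun i j => hG _ _) hdet
  calc |x c| ≤ |B.det| * |x c| := le_mul_of_one_le_left (abs_nonneg _) hdet_le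
    _ = |B.cramer g ⟨c, hc⟩| * ε := by
      rw [← abs_mul, hcramer ⟨c, hc⟩, hscale, map_smul, Pi.smul_apply, smul_eq_mul, abs_mul,
        abs_of_pos hε, mul_comm]
    _ ≤ minorBound G * ε := mul_le_mul_of_nonneg_right
      (abs_cramer_submatrix_le_minorBound G hf Subtype.val_injective hg_le _) hε.le

lemma one_le_minorBound_mul_abs (hG : ∀ r c, G r c ∈ (Int.castRingHom ℝ).range)
    (hx : LinearIndepOn ℝ G.col x.support)
    (hGx : ∀ r, (G *ᵥ x) r ∈ (Int.castRingHom ℝ).range) {c : C} (hc : x c ≠ 0) :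
    1 ≤ minorBound G * |x c| := by
  classical
  obtain ⟨f, hf, hdet, hcramer⟩ := exists_det_mul_eq_cramer hx
  set B := G.submatrix f Subtype.val
  have hint : B.det * x c ∈ (Int.castRingHom ℝ).range := by
    rw [hcramer ⟨c, hc⟩, Matrix.cramer_apply]
    refine det_mem_of_forall_mem fun i j => ?_
    rw [Matrix.updateCol_apply]
    split_ifs
    · exact hGx _
    · exact hG _ _
  calc 1 ≤ |B.det * x c| := one_le_abs_of_mem_intRange hint (mul_ne_zero hdet hc)
    _ = |B.det| * |x c| := abs_mul _ _
    _ ≤ minorBound G * |x c| := mul_le_mul_of_nonneg_right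
      (abs_det_submatrix_le_minorBound G hf Subtype.val_injective) (abs_nonneg _)

lemma abs_mulVec_le_minorBound_mul (hδ : 0 ≤ δ) (hx : ∀ c, |x c| ≤ δ) (r : R) :
    |(G *ᵥ x) r| ≤ minorBound G * δ :=
  calc |(G *ᵥ x) r| ≤ ∑ c, |G r c * x c| :=
        Finset.abs_sum_le_sum_abs (fun c => G r c * x c) Finset.univ
    _ ≤ ∑ c, |G r c| * δ := Finset.sum_le_sum fun c _ =>
        (abs_mul _ _).trans_le (mul_le_mul_of_nonneg_left (hx c) (abs_nonneg _))
    _ = (∑ c, |G r c|) * δ := (Finset.sum_mul _ _ _).symm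
    _ ≤ minorBound G * δ := mul_le_mul_of_nonneg_right
        ((le_add_of_nonneg_left zero_le_one).trans (one_add_sum_abs_le_minorBound G r)) hδ

lemma exists_solution_near_of_support (hG : ∀ r c, G r c ∈ (Int.castRingHom ℝ).range)
    (hxz : G *ᵥ x = G *ᵥ z) (hδ : 0 < δ) (hx : ∀ c, z c = 0 → |x c| ≤ δ) :
    ∃ p : C → ℝ, p.support ⊆ z.support ∧ G *ᵥ p = G *ᵥ z ∧
      ∀ c, |p c - x c| ≤ minorBound G ^ 2 * δ := by
  classical
  have hΔ := one_le_minorBound G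
  -- `xOut` is the part of `x` outside the support of `z`
  set xOut : C → ℝ := fun c => if z c = 0 then x c else 0 with hxOut
  have hOut (c : C) : |xOut c| ≤ δ := by
    rw [hxOut]
    dsimp only
    split_ifs with hc
    · exact hx c hc
    · rw [abs_zero]
      exact hδ.le
  have hsupp : (z - (x - xOut)).support ⊆ z.support := fun c hc hzc =>
    hc (by simp only [hxOut, Pi.sub_apply, hzc, if_true, sub_self])
  obtain ⟨d, hdz, hGd, hdli⟩ := exists_basic_solution G (z - (x - xOut))
  rw [Matrix.mulVec_sub, Matrix.mulVec_sub, hxz, sub_sub_cancel] at hGd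
  have hd (c : C) : |d c| ≤ minorBound G ^ 2 * δ := by
    rw [sq, mul_assoc]
    exact abs_le_of_linearIndepOn_support hG hdli (by positivity)
      (hGd ▸ abs_mulVec_le_minorBound_mul hδ.le hOut) c
  refine ⟨x - xOut + d, fun c hc hzc => hc ?_, ?_, fun c => ?_⟩
  · have hdc : d c = 0 := Function.notMem_support.1 fun h => hsupp (hdz h) hzc
    simp only [hxOut, Pi.add_apply, Pi.sub_apply, hzc, if_true, sub_self, hdc, add_zero]
  · rw [Matrix.mulVec_add, Matrix.mulVec_sub, hGd, sub_add_cancel, hxz]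
  · by_cases hzc : z c = 0
    · have hdc : d c = 0 := Function.notMem_support.1 fun h => hsupp (hdz h) hzc
      rw [Pi.add_apply, Pi.sub_apply, hdc, add_zero, sub_sub_cancel_left, abs_neg]
      exact (hOut c).trans (le_mul_of_one_le_left hδ.le (one_le_pow₀ hΔ))
    · simpa only [hxOut, Pi.add_apply, Pi.sub_apply, if_neg hzc, sub_zero, add_sub_cancel_left]
        using hd c

end IntegralSystem

section Nearest

variable {ι : Type} [Fintype ι] {F : Set (ι → ℝ)} {x p p' : ι → ℝ}

lemma exists_norm2_sub_le (hF : IsClosed F) (hne : F.Nonempty) (x : ι → ℝ) :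
    ∃ p ∈ F, ∀ q ∈ F, norm2 (p - x) ≤ norm2 (q - x) := by
  have hcl : IsClosed ((WithLp.ofLp : EuclideanSpace ℝ ι → ι → ℝ) ⁻¹' F) :=
    hF.preimage (PiLp.continuous_ofLp 2 _)
  obtain ⟨p₀, hp₀⟩ := hne
  obtain ⟨p, hp, hdist⟩ := hcl.exists_infDist_eq_dist ⟨WithLp.toLp 2 p₀, hp₀⟩ (WithLp.toLp 2 x)
  refine ⟨p.ofLp, hp, fun q hq => ?_⟩
  have h : dist (WithLp.toLp 2 x) p ≤ dist (WithLp.toLp 2 x) (WithLp.toLp 2 q) :=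
    hdist ▸ Metric.infDist_le_dist_of_mem hq
  rw [dist_comm, dist_comm _ (WithLp.toLp 2 q), dist_eq_norm, dist_eq_norm] at h
  rwa [norm2_eq_norm, norm2_eq_norm, WithLp.toLp_sub, WithLp.toLp_sub]

lemma eq_of_forall_norm2_sub_le (hF : Convex ℝ F) (hp : p ∈ F) (hp' : p' ∈ F)
    (h : ∀ q ∈ F, norm2 (p - x) ≤ norm2 (q - x))
    (h' : ∀ q ∈ F, norm2 (p' - x) ≤ norm2 (q - x)) : p' = p := by
  set q := midpoint ℝ p p' with hq
  have hparallelogram : norm2 (p' - p) ^ 2 =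
      2 * norm2 (p - x) ^ 2 + 2 * norm2 (p' - x) ^ 2 - 4 * norm2 (q - x) ^ 2 := by
    simp only [norm2_sq, Finset.mul_sum, ← Finset.sum_add_distrib, ← Finset.sum_sub_distrib]
    refine Finset.sum_congr rfl fun i _ => ?_
    simp only [hq, midpoint_eq_smul_add, Pi.sub_apply, Pi.smul_apply, Pi.add_apply, smul_eq_mul,
      invOf_eq_inv]
    ring
  have hqF := hF.midpoint_mem hp hp'
  have hle := pow_le_pow_left₀ (norm2_nonneg _) (h q hqF) 2
  have hle' := pow_le_pow_left₀ (norm2_nonneg _) (h' q hqF) 2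
  have hzero : norm2 (p' - p) = 0 := by nlinarith [norm2_nonneg (p' - p)]
  funext i
  exact sub_eq_zero.1 (abs_nonpos_iff.1 ((abs_le_norm2 _ i).trans_eq hzero))

end Nearest

section Rounding

variable {m n : ℕ} {A : Matrix (Fin m) (Fin n) ℝ} {b : Fin m → ℝ} {c : Fin n → ℝ} {θ : ℝ}
  {X Z P : Point m n} {p : Idx m n ⊕ Idx m n}

/-- The constraint matrix `[I, -M]` of the embedding, acting on `(w; z)`; here `M` is
`sdMatrix A b c`. -/
def conMatrix (A : Matrix (Fin m) (Fin n) ℝ) (b : Fin m → ℝ) (c : Fin n → ℝ) :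
    Matrix (Idx m n) (Idx m n ⊕ Idx m n) ℝ :=
  Matrix.fromCols 1 (-sdMatrix A b c)

lemma satisfiesEqs_iff_conMatrix_mulVec :
    SatisfiesEqs A b c Z ↔ conMatrix A b c *ᵥ Z = sdRhs m n := by
  have hmul : conMatrix A b c *ᵥ Z = slk Z - sdMatrix A b c *ᵥ var Z := by
    rw [conMatrix, Matrix.fromCols_mulVec, Matrix.one_mulVec, Matrix.neg_mulVec, ← sub_eq_add_neg]
    rfl
  rw [hmul, SatisfiesEqs, sub_eq_iff_eq_add']

lemma sdMatrix_mem {s : Subring ℝ} (hA : ∀ i j, A i j ∈ s) (hb : ∀ i, b i ∈ s)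
    (hc : ∀ j, c j ∈ s) (p q : Idx m n) : sdMatrix A b c p q ∈ s := by
  have hbBar (i : Fin m) : bBar A b i ∈ s :=
    add_mem (sub_mem (hb i) (sum_mem fun j _ => hA i j)) (one_mem s)
  have hcBar (j : Fin n) : cBar A c j ∈ s :=
    sub_mem (add_mem (sum_mem fun i _ => hA i j) (one_mem s)) (hc j)
  have hoBar : oBar b c ∈ s :=
    sub_mem (add_mem (one_mem s) (sum_mem fun j _ => hc j)) (sum_mem fun i _ => hb i)
  rcases p with i | j | _ | _ <;> rcases q with i' | j' | _ | _ <;>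
    simp only [sdMatrix, Matrix.of_apply, neg_mem_iff, zero_mem, hA, hb, hc, hbBar, hcBar, hoBar]

lemma conMatrix_mem {s : Subring ℝ} (hA : ∀ i j, A i j ∈ s) (hb : ∀ i, b i ∈ s)
    (hc : ∀ j, c j ∈ s) (p : Idx m n) (q : Idx m n ⊕ Idx m n) : conMatrix A b c p q ∈ s := by
  rcases q with q | q
  · rw [conMatrix, Matrix.fromCols_apply_inl, Matrix.one_apply]
    split_ifs
    exacts [one_mem s, zero_mem s]
  · exact neg_mem (sdMatrix_mem hA hb hc p q)

lemma sdRhs_mem (s : Subring ℝ) (p : Idx m n) : sdRhs m n p ∈ s := by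
  rw [sdRhs]
  split_ifs
  exacts [add_mem (add_mem (natCast_mem s n) (natCast_mem s m)) (ofNat_mem s 2), zero_mem s]

lemma SatisfiesEqs.mu_eq_zero_of_support_subset (hP : SatisfiesEqs A b c P)
    (hZ : SatisfiesEqs A b c Z) (hμ : mu Z = 0) (h : P.support ⊆ Z.support) : mu P = 0 := by
  rw [hP.mu_eq]
  exact Function.notMem_support.1 fun hγ => h hγ (hZ.mu_eq.symm.trans hμ)

-- There are no recession directions, because `∑ (z + w) = N (1 + μ)` on the feasible set.
lemma eq_zero_of_conMatrix_mulVec_eq_zero {v : Point m n} (hv : 0 ≤ v)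
    (hγ : var v (iGam m n) = 0) (h : conMatrix A b c *ᵥ v = 0) : v = 0 := by
  have hones : SatisfiesEqs A b c (ones m n) := satisfiesEqs_ones
  have heqs : SatisfiesEqs A b c (ones m n + v) := by
    rw [satisfiesEqs_iff_conMatrix_mulVec, Matrix.mulVec_add, h, add_zero]
    exact satisfiesEqs_iff_conMatrix_mulVec.1 hones
  have hμ : mu (ones m n + v) = mu (ones m n) := by
    rw [heqs.mu_eq, hones.mu_eq]
    exact (congrArg (1 + ·) hγ).trans (add_zero 1)
  have hsum := heqs.sum_var_add_slk
  rw [hμ, ← hones.sum_var_add_slk] at hsum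
  simp only [var, slk, Pi.add_apply, Finset.sum_add_distrib] at hsum
  have hzero : ∑ q, v q = 0 := by
    rw [Fintype.sum_sum_type]
    linarith
  exact (Fintype.sum_eq_zero_iff_of_nonneg hv).1 hzero

lemma exists_optimal_one_le_minorBound_mul
    (hG : ∀ p q, conMatrix A b c p q ∈ (Int.castRingHom ℝ).range) (hZ : Z ∈ feasible A b c)
    (hμ : mu Z = 0) (hp : 0 < Z p) :
    ∃ P ∈ feasible A b c, mu P = 0 ∧ 1 ≤ minorBound (conMatrix A b c) * P p := by
  have hGZ := satisfiesEqs_iff_conMatrix_mulVec.1 hZ.1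
  obtain ⟨P, hP, hPZ, hGP, hli, hPp⟩ := exists_nonneg_basic_solution (nonneg_of_mem_feasible hZ)
    (fun v hvZ hv hGv => eq_zero_of_conMatrix_mulVec_eq_zero hv
      (Function.notMem_support.1 fun hγ => hvZ hγ (hZ.1.mu_eq.symm.trans hμ)) hGv) hp
  have heqs : SatisfiesEqs A b c P := satisfiesEqs_iff_conMatrix_mulVec.2 (hGP.trans hGZ)
  refine ⟨P, ⟨heqs, fun i => hP _, fun i => hP _⟩,
    heqs.mu_eq_zero_of_support_subset hZ.1 hμ hPZ, ?_⟩
  have h := one_le_minorBound_mul_abs hG hli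
    (fun r => by rw [hGP, hGZ]; exact sdRhs_mem _ r) hPp.ne'
  rwa [abs_of_pos hPp] at h

lemma mul_swap_le_dim_mul_mu (hX : X ∈ feasible A b c) (hP : P ∈ feasible A b c) (hμ : mu P = 0)
    (p : Idx m n ⊕ Idx m n) : P p * X p.swap ≤ dim m n * mu X := by
  have hnonneg (i : Idx m n) : 0 ≤ var P i * slk X i ∧ 0 ≤ slk P i * var X i :=
    ⟨mul_nonneg (hP.2.1 i) (hX.2.2 i), mul_nonneg (hP.2.2 i) (hX.2.1 i)⟩
  have hle (i : Idx m n) : var P i * slk X i + slk P i * var X i ≤ dim m n * mu X := by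
    rw [← dotProduct_eq_dim_mul_mu, dotProduct, ← hX.1.cross_sum_eq hP.1 hμ]
    exact Finset.single_le_sum (f := fun i => var P i * slk X i + slk P i * var X i)
      (fun j _ => add_nonneg (hnonneg j).1 (hnonneg j).2) (Finset.mem_univ i)
  rcases p with i | i
  · exact (le_add_of_nonneg_left (hnonneg i).1).trans (hle i)
  · exact (le_add_of_nonneg_right (hnonneg i).2).trans (hle i)

lemma swap_le_of_pos (hG : ∀ p q, conMatrix A b c p q ∈ (Int.castRingHom ℝ).range)
    (hX : X ∈ feasible A b c) (hZ : Z ∈ feasible A b c) (hμ : mu Z = 0) (hp : 0 < Z p) :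
    X p.swap ≤ dim m n * minorBound (conMatrix A b c) * mu X := by
  obtain ⟨P, hP, hPμ, hPp⟩ := exists_optimal_one_le_minorBound_mul hG hZ hμ hp
  have hΔ := zero_le_one.trans (one_le_minorBound (conMatrix A b c))
  calc X p.swap ≤ minorBound (conMatrix A b c) * P p * X p.swap :=
        le_mul_of_one_le_left (nonneg_of_mem_feasible hX _) hPp
    _ = minorBound (conMatrix A b c) * (P p * X p.swap) := mul_assoc _ _ _
    _ ≤ minorBound (conMatrix A b c) * (dim m n * mu X) :=
        mul_le_mul_of_nonneg_left (mul_swap_le_dim_mul_mu hX hP hPμ p) hΔ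
    _ = dim m n * minorBound (conMatrix A b c) * mu X := by ring

lemma one_sub_le_of_pos (hG : ∀ p q, conMatrix A b c p q ∈ (Int.castRingHom ℝ).range)
    (hX : X ∈ nbhd A b c θ) (hZ : Z ∈ feasible A b c) (hμ : mu Z = 0) (hp : 0 < Z p) :
    1 - θ ≤ dim m n * minorBound (conMatrix A b c) * X p := by
  have hprod : (1 - θ) * mu X ≤ X p * X p.swap := by
    rcases p with i | i
    · exact (mul_mu_le_of_mem_nbhd hX i).trans_eq (mul_comm _ _)
    · exact mul_mu_le_of_mem_nbhd hX i
  refine le_of_mul_le_mul_right ?_ (mu_pos_of_mem_interiorFeasible hX.1)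
  calc (1 - θ) * mu X ≤ X p * X p.swap := hprod
    _ ≤ X p * (dim m n * minorBound (conMatrix A b c) * mu X) :=
        mul_le_mul_of_nonneg_left (swap_le_of_pos hG hX.1.1 hZ hμ hp)
          (nonneg_of_mem_feasible hX.1.1 p)
    _ = dim m n * minorBound (conMatrix A b c) * X p * mu X := by ring

lemma swap_lt_of_pos (hG : ∀ p q, conMatrix A b c p q ∈ (Int.castRingHom ℝ).range)
    (hX : X ∈ nbhd A b c θ) (hZ : Z ∈ feasible A b c) (hμ : mu Z = 0)
    (hsmall : dim m n ^ 2 * minorBound (conMatrix A b c) ^ 2 * mu X < 1 - θ) (hp : 0 < Z p) :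
    X p.swap < X p := by
  have hdim := dim_pos m n
  have hΔ := zero_lt_one.trans_le (one_le_minorBound (conMatrix A b c))
  refine (swap_le_of_pos hG hX.1.1 hZ hμ hp).trans_lt
    (lt_of_mul_lt_mul_left ?_ (mul_pos hdim hΔ).le)
  calc _ = dim m n ^ 2 * minorBound (conMatrix A b c) ^ 2 * mu X := by ring
    _ < 1 - θ := hsmall
    _ ≤ _ := one_sub_le_of_pos hG hX hZ hμ hp

lemma IsStrictOptimal.swap_pos_of_eq_zero (hZ : IsStrictOptimal A b c Z) (hp : Z p = 0) :
    0 < Z p.swap := by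
  rcases p with i | i
  · exact (hZ.2.2 i).2.trans_eq (by rw [slk, hp, add_zero]; rfl)
  · exact (hZ.2.2 i).2.trans_eq (by rw [var, hp, zero_add]; rfl)

lemma isStrictOptimal_of_support_subset (hZ : IsStrictOptimal A b c Z)
    (hP : SatisfiesEqs A b c P) (hPZ : P.support ⊆ Z.support) (hpos : ∀ p, 0 < Z p → 0 < P p) :
    IsStrictOptimal A b c P := by
  have hP₀ (p : Idx m n ⊕ Idx m n) : 0 ≤ P p := by
    rcases (nonneg_of_mem_feasible hZ.1 p).eq_or_lt with hp | hp
    · exact (Function.notMem_support.1 fun h => hPZ h hp.symm).ge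
    · exact (hpos p hp).le
  refine isStrictOptimal_of_mu_eq_zero ⟨hP, fun i => hP₀ _, fun i => hP₀ _⟩
    (hP.mu_eq_zero_of_support_subset hZ.1.1 hZ.mu_eq_zero hPZ) fun i => ?_
  rcases (hZ.1.2.1 i).eq_or_lt with hi | hi
  · exact add_pos_of_nonneg_of_pos (hP₀ _) (hpos _ (hZ.swap_pos_of_eq_zero (p := .inr i) hi.symm))
  · exact add_pos_of_pos_of_nonneg (hpos (.inr i) hi) (hP₀ _)

lemma convex_guessedFace (X : Point m n) : Convex ℝ (guessedFace A b c X) := by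
  rintro P ⟨hP, hPX⟩ Q ⟨hQ, hQX⟩ s t - - hst
  rw [satisfiesEqs_iff_conMatrix_mulVec] at hP hQ
  refine ⟨?_, fun i => ⟨fun hi => ?_, fun hi => ?_⟩⟩
  · rw [satisfiesEqs_iff_conMatrix_mulVec, Matrix.mulVec_add, Matrix.mulVec_smul,
      Matrix.mulVec_smul, hP, hQ, ← add_smul, hst, one_smul]
  · change s * var P i + t * var Q i = 0
    rw [(hPX i).1 hi, (hQX i).1 hi, mul_zero, mul_zero, add_zero]
  · change s * slk P i + t * slk Q i = 0
    rw [(hPX i).2 hi, (hQX i).2 hi, mul_zero, mul_zero, add_zero]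

lemma isClosed_guessedFace (X : Point m n) : IsClosed (guessedFace A b c X) := by
  simp only [guessedFace, Set.ofPred_forall, Set.ofPred_and]
  exact isClosed_satisfiesEqs.inter <| isClosed_iInter fun i => .inter
    (isClosed_iInter fun _ => isClosed_eq (continuous_apply (Sum.inr i)) continuous_const)
    (isClosed_iInter fun _ => isClosed_eq (continuous_apply (Sum.inl i)) continuous_const)

lemma guessedFace_eq_of_forall_swap_lt (hZ : IsStrictOptimal A b c Z)
    (h : ∀ p, 0 < Z p → X p.swap < X p) :
    guessedFace A b c X = {P | SatisfiesEqs A b c P ∧ P.support ⊆ Z.support} := by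
  have hzero (p : Idx m n ⊕ Idx m n) (hp : X p ≤ X p.swap) : Z p = 0 :=
    ((nonneg_of_mem_feasible hZ.1 p).eq_or_lt.resolve_right fun hpos => (h p hpos).not_ge hp).symm
  have hlt (p : Idx m n ⊕ Idx m n) (hp : Z p = 0) : X p < X p.swap := by
    simpa only [Sum.swap_swap] using h p.swap (hZ.swap_pos_of_eq_zero hp)
  ext P
  refine and_congr_right fun _ =>
    ⟨fun hP p hPp hp => hPp ?_, fun hP i => ⟨fun hi => ?_, fun hi => ?_⟩⟩
  · rcases p with i | i
    · exact (hP i).2 (hlt _ hp)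
    · exact (hP i).1 (hlt _ hp).le
  · exact Function.notMem_support.1 fun hPi => hP hPi (hzero (.inr i) hi)
  · exact Function.notMem_support.1 fun hPi => hP hPi (hzero (.inl i) hi.le)

lemma exists_near_of_support (hG : ∀ p q, conMatrix A b c p q ∈ (Int.castRingHom ℝ).range)
    (hX : X ∈ interiorFeasible A b c) (hZ : IsStrictOptimal A b c Z) :
    ∃ P : Point m n, SatisfiesEqs A b c P ∧ P.support ⊆ Z.support ∧
      norm2 (P - X) ≤ 2 * dim m n ^ 2 * minorBound (conMatrix A b c) ^ 3 * mu X := by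
  have hdim := dim_pos m n
  have hμ := mu_pos_of_mem_interiorFeasible hX
  have hΔ := zero_lt_one.trans_le (one_le_minorBound (conMatrix A b c))
  have hGX := satisfiesEqs_iff_conMatrix_mulVec.1 hX.1.1
  have hGZ := satisfiesEqs_iff_conMatrix_mulVec.1 hZ.1.1
  have hsmall (p : Idx m n ⊕ Idx m n) (hp : Z p = 0) :
      |X p| ≤ dim m n * minorBound (conMatrix A b c) * mu X := by
    rw [abs_of_nonneg (nonneg_of_mem_feasible hX.1 p)]
    simpa only [Sum.swap_swap] using
      swap_le_of_pos hG hX.1 hZ.1 hZ.mu_eq_zero (hZ.swap_pos_of_eq_zero hp)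
  obtain ⟨P, hPZ, hGP, hPX⟩ :=
    exists_solution_near_of_support hG (hGX.trans hGZ.symm) (by positivity) hsmall
  refine ⟨P, satisfiesEqs_iff_conMatrix_mulVec.2 (hGP.trans hGZ), hPZ, ?_⟩
  calc norm2 (P - X) ≤ ∑ p, |(P - X) p| := norm2_le_sum_abs _
    _ ≤ ∑ _p : Idx m n ⊕ Idx m n, minorBound (conMatrix A b c) ^ 2 *
          (dim m n * minorBound (conMatrix A b c) * mu X) := Finset.sum_le_sum fun p _ => hPX p
    _ = 2 * dim m n ^ 2 * minorBound (conMatrix A b c) ^ 3 * mu X := by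
        rw [Finset.sum_const, Finset.card_univ, Fintype.card_sum, nsmul_eq_mul, Nat.cast_add,
          card_idx]
        ring

lemma pos_of_norm2_sub_le (hG : ∀ p q, conMatrix A b c p q ∈ (Int.castRingHom ℝ).range)
    (hX : X ∈ nbhd A b c θ) (hZ : Z ∈ feasible A b c) (hμ : mu Z = 0)
    (hsmall : 2 * dim m n ^ 3 * minorBound (conMatrix A b c) ^ 4 * mu X < 1 - θ)
    (hPX : norm2 (P - X) ≤ 2 * dim m n ^ 2 * minorBound (conMatrix A b c) ^ 3 * mu X)
    (hp : 0 < Z p) : 0 < P p := by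
  have hΔ := zero_lt_one.trans_le (one_le_minorBound (conMatrix A b c))
  have hXp : 2 * dim m n ^ 2 * minorBound (conMatrix A b c) ^ 3 * mu X < X p := by
    refine lt_of_mul_lt_mul_left (?_ : dim m n * minorBound (conMatrix A b c) * _ < _)
      (mul_pos (dim_pos m n) hΔ).le
    calc _ = 2 * dim m n ^ 3 * minorBound (conMatrix A b c) ^ 4 * mu X := by ring
      _ < 1 - θ := hsmall
      _ ≤ _ := one_sub_le_of_pos hG hX hZ hμ hp
  have hdist := (abs_le.1 ((abs_le_norm2 (P - X) p).trans hPX)).1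
  rw [Pi.sub_apply] at hdist
  linarith

lemma exists_unique_isRounding_isStrictOptimal
    (hG : ∀ p q, conMatrix A b c p q ∈ (Int.castRingHom ℝ).range) (hX : X ∈ nbhd A b c θ)
    (hZ : IsStrictOptimal A b c Z)
    (hsmall : 2 * dim m n ^ 3 * minorBound (conMatrix A b c) ^ 4 * mu X < 1 - θ) :
    ∃ P, IsRounding A b c X P ∧ (∀ Q, IsRounding A b c X Q → Q = P) ∧
      IsStrictOptimal A b c P := by
  have hdim := two_le_dim m n
  have hΔ := one_le_minorBound (conMatrix A b c)
  have hμX := mu_pos_of_mem_interiorFeasible hX.1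
  have hsmall' : dim m n ^ 2 * minorBound (conMatrix A b c) ^ 2 * mu X < 1 - θ := by
    refine lt_of_le_of_lt ?_ hsmall
    gcongr ?_ * ?_ * mu X
    · nlinarith [sq_nonneg (dim m n)]
    · exact pow_le_pow_right₀ hΔ (by norm_num)
  have hface := guessedFace_eq_of_forall_swap_lt hZ fun p =>
    swap_lt_of_pos hG hX hZ.1 hZ.mu_eq_zero hsmall'
  obtain ⟨P', hP', hP'Z, hP'X⟩ := exists_near_of_support hG hX.1 hZ
  have hP'face : P' ∈ guessedFace A b c X := hface ▸ ⟨hP', hP'Z⟩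
  obtain ⟨P, hP, hPmin⟩ := exists_norm2_sub_le (isClosed_guessedFace X) ⟨P', hP'face⟩ X
  obtain ⟨hPeqs, hPZ⟩ := hface ▸ hP
  refine ⟨P, ⟨hP, hPmin⟩, fun Q hQ =>
    eq_of_forall_norm2_sub_le (convex_guessedFace X) hP hQ.1 hPmin hQ.2,
    isStrictOptimal_of_support_subset hZ hPeqs hPZ fun p => ?_⟩
  exact pos_of_norm2_sub_le hG hX hZ.1 hZ.mu_eq_zero hsmall ((hPmin P' hP'face).trans hP'X)

end Rounding

section Size

lemma one_add_sum_le_prod {ι R : Type*} [CommSemiring R] [PartialOrder R] [IsOrderedRing R]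
    (s : Finset ι) {f : ι → R} (hf : ∀ i, 0 ≤ f i) : 1 + ∑ i ∈ s, f i ≤ ∏ i ∈ s, (1 + f i) := by
  classical
  induction s using Finset.induction_on with
  | empty => simp
  | insert i s hi ih =>
    have hone : 1 ≤ ∏ j ∈ s, (1 + f j) :=
      (le_add_of_nonneg_right (Finset.sum_nonneg fun j _ => hf j)).trans ih
    calc 1 + ∑ j ∈ insert i s, f j = (1 + ∑ j ∈ s, f j) + f i * 1 := by
          rw [Finset.sum_insert hi, mul_one, add_comm (f i), add_assoc]
      _ ≤ ∏ j ∈ s, (1 + f j) + f i * ∏ j ∈ s, (1 + f j) :=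
          add_le_add ih (mul_le_mul_of_nonneg_left hone (hf i))
      _ = ∏ j ∈ insert i s, (1 + f j) := by rw [Finset.prod_insert hi, add_mul, one_mul]

lemma one_add_sum_abs_le_prod {ι : Type*} [Fintype ι] (f : ι → ℝ) :
    1 + ∑ i, |f i| ≤ ∏ i, (1 + |f i|) :=
  one_add_sum_le_prod _ fun _ => abs_nonneg _

lemma one_add_add_le_mul {s t S T : ℝ} (hs : 0 ≤ s) (ht : 0 ≤ t) (hsS : 1 + s ≤ S)
    (htT : 1 + t ≤ T) : 1 + (s + t) ≤ S * T := by
  nlinarith [mul_nonneg hs ht, mul_le_mul hsS htT (by linarith) (by linarith)]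

lemma one_add_abs_intCast_le_two_pow_clog (t : ℤ) :
    1 + |(t : ℝ)| ≤ 2 ^ Nat.clog 2 (t.natAbs + 1) := by
  rw [← Int.cast_abs, ← Nat.cast_natAbs, add_comm]
  exact_mod_cast Nat.le_pow_clog one_lt_two (t.natAbs + 1)

variable {m n : ℕ} {A : Matrix (Fin m) (Fin n) ℝ} {b : Fin m → ℝ} {c : Fin n → ℝ}

/-- The product of `1 + |t|` over all entries `t` of the data `(A, b, c)`: a real-valued
counterpart of `2 ^ L`, where `L` is the binary length of integer data. -/
def dataBound (A : Matrix (Fin m) (Fin n) ℝ) (b : Fin m → ℝ) (c : Fin n → ℝ) : ℝ :=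
  (∏ i, ∏ j, (1 + |A i j|)) * (∏ i, (1 + |b i|)) * ∏ j, (1 + |c j|)

lemma abs_bBar_le (i : Fin m) : |bBar A b i| ≤ |b i| + ∑ j, |A i j| + 1 := by
  have h := Finset.abs_sum_le_sum_abs (A i) Finset.univ
  rw [bBar]
  linarith [abs_add_le (b i - ∑ j, A i j) 1, abs_sub (b i) (∑ j, A i j), abs_one (α := ℝ)]

lemma abs_cBar_le (j : Fin n) : |cBar A c j| ≤ ∑ i, |A i j| + |c j| + 1 := by
  have h := Finset.abs_sum_le_sum_abs (A · j) Finset.univ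
  rw [cBar]
  linarith [abs_sub (∑ i, A i j + 1) (c j), abs_add_le (∑ i, A i j) 1, abs_one (α := ℝ)]

lemma abs_oBar_le : |oBar b c| ≤ ∑ i, |b i| + ∑ j, |c j| + 1 := by
  have hb := Finset.abs_sum_le_sum_abs b Finset.univ
  have hc := Finset.abs_sum_le_sum_abs c Finset.univ
  rw [oBar]
  linarith [abs_sub (1 + ∑ j, c j) (∑ i, b i), abs_add_le 1 (∑ j, c j), abs_one (α := ℝ)]

lemma one_add_sum_abs_conMatrix (p : Idx m n) :
    1 + ∑ q, |conMatrix A b c p q| = 2 + ∑ q, |sdMatrix A b c p q| := by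
  have hone : ∑ q, |(1 : Matrix (Idx m n) (Idx m n) ℝ) p q| = 1 := by
    simp [Matrix.one_apply, apply_ite abs]
  simp only [conMatrix, Fintype.sum_sum_type, Matrix.fromCols_apply_inl, hone,
    Matrix.fromCols_apply_inr, Matrix.neg_apply, abs_neg]
  ring

lemma one_add_sum_abs_conMatrix_inl_le (i : Fin m) :
    1 + ∑ q, |conMatrix A b c (.inl i) q| ≤ 4 * ((∏ j, (1 + |A i j|)) * (1 + |b i|)) := by
  have hA : 0 ≤ ∑ j, |A i j| := by positivity
  have hmul := one_add_add_le_mul hA (abs_nonneg (b i)) (one_add_sum_abs_le_prod (A i)) le_rfl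
  have hrow : ∑ q, |sdMatrix A b c (.inl i) q| =
      ∑ j, |A i j| + (|b i| + |bBar A b i|) := by simp [sdMatrix]
  rw [one_add_sum_abs_conMatrix, hrow]
  linarith [abs_bBar_le (A := A) (b := b) i, abs_nonneg (b i)]

lemma one_add_sum_abs_conMatrix_inr_inl_le (j : Fin n) :
    1 + ∑ q, |conMatrix A b c (.inr (.inl j)) q| ≤
      4 * ((∏ i, (1 + |A i j|)) * (1 + |c j|)) := by
  have hA : 0 ≤ ∑ i, |A i j| := by positivity
  have hmul := one_add_add_le_mul hA (abs_nonneg (c j)) (one_add_sum_abs_le_prod (A · j)) le_rfl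
  have hrow : ∑ q, |sdMatrix A b c (.inr (.inl j)) q| =
      ∑ i, |A i j| + (|c j| + |cBar A c j|) := by simp [sdMatrix]
  rw [one_add_sum_abs_conMatrix, hrow]
  linarith [abs_cBar_le (A := A) (c := c) j, abs_nonneg (c j)]

lemma one_add_sum_abs_conMatrix_iTau_le :
    1 + ∑ q, |conMatrix A b c (iTau m n) q| ≤
      4 * ((∏ i, (1 + |b i|)) * ∏ j, (1 + |c j|)) := by
  have hb : 0 ≤ ∑ i, |b i| := by positivity
  have hc : 0 ≤ ∑ j, |c j| := by positivity
  have hmul := one_add_add_le_mul hb hc (one_add_sum_abs_le_prod b) (one_add_sum_abs_le_prod c)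
  have hrow : ∑ q, |sdMatrix A b c (iTau m n) q| =
      ∑ i, |b i| + (∑ j, |c j| + |oBar b c|) := by simp [sdMatrix, iTau]
  rw [one_add_sum_abs_conMatrix, hrow]
  linarith [abs_oBar_le (b := b) (c := c)]

lemma one_add_sum_abs_conMatrix_iGam_le :
    1 + ∑ q, |conMatrix A b c (iGam m n) q| ≤ 2 * dim m n * dataBound A b c := by
  set a := ∑ i, ∑ j, |A i j| with ha_def
  have ha : 0 ≤ a := by positivity
  have hb : 0 ≤ ∑ i, |b i| := by positivity
  have hc : 0 ≤ ∑ j, |c j| := by positivity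
  have hA : 1 + a ≤ ∏ i, ∏ j, (1 + |A i j|) :=
    (one_add_sum_le_prod _ fun i => by positivity).trans
      (Finset.prod_le_prod (fun i _ => by positivity) fun i _ => one_add_sum_abs_le_prod (A i))
  have hdata : 1 + (a + ∑ i, |b i| + ∑ j, |c j|) ≤ dataBound A b c :=
    one_add_add_le_mul (add_nonneg ha hb) hc
      (one_add_add_le_mul ha hb hA (one_add_sum_abs_le_prod b)) (one_add_sum_abs_le_prod c)
  have hbBar : ∑ i, |bBar A b i| ≤ ∑ i, |b i| + a + m :=
    (Finset.sum_le_sum fun i _ => abs_bBar_le i).trans_eq (by simp [Finset.sum_add_distrib, a])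
  have hcBar : ∑ j, |cBar A c j| ≤ a + ∑ j, |c j| + n := by
    refine (Finset.sum_le_sum fun j _ => abs_cBar_le j).trans_eq ?_
    rw [ha_def, Finset.sum_comm]
    simp [Finset.sum_add_distrib]
  refine le_trans ?_ (mul_le_mul_of_nonneg_left hdata (mul_pos two_pos (dim_pos m n)).le)
  have hrow : ∑ q, |sdMatrix A b c (iGam m n) q| =
      ∑ i, |bBar A b i| + (∑ j, |cBar A c j| + |oBar b c|) := by simp [sdMatrix, iGam]
  rw [one_add_sum_abs_conMatrix, hrow, dim]
  nlinarith [abs_oBar_le (b := b) (c := c), m.cast_nonneg (α := ℝ), n.cast_nonneg (α := ℝ)]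

lemma minorBound_conMatrix_le :
    minorBound (conMatrix A b c) ≤ 4 ^ (m + n + 1) * (2 * dim m n) * dataBound A b c ^ 3 := by
  have hm := Finset.prod_le_prod (s := Finset.univ) (fun i _ => by positivity) fun i _ =>
    one_add_sum_abs_conMatrix_inl_le (A := A) (b := b) (c := c) i
  have hn := Finset.prod_le_prod (s := Finset.univ) (fun j _ => by positivity) fun j _ =>
    one_add_sum_abs_conMatrix_inr_inl_le (A := A) (b := b) (c := c) j
  have hτ := one_add_sum_abs_conMatrix_iTau_le (A := A) (b := b) (c := c)
  have hγ := one_add_sum_abs_conMatrix_iGam_le (A := A) (b := b) (c := c)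
  have hcomm : ∏ j, ∏ i, (1 + |A i j|) = ∏ i, ∏ j, (1 + |A i j|) := Finset.prod_comm
  simp only [Finset.prod_mul_distrib, Finset.prod_const, Finset.card_univ, Fintype.card_fin,
    hcomm] at hm hn
  calc minorBound (conMatrix A b c)
      = (∏ i : Fin m, (1 + ∑ q, |conMatrix A b c (.inl i) q|)) *
        ((∏ j : Fin n, (1 + ∑ q, |conMatrix A b c (.inr (.inl j)) q|)) *
        ((1 + ∑ q, |conMatrix A b c (iTau m n) q|) *
          (1 + ∑ q, |conMatrix A b c (iGam m n) q|))) := by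
        simp only [minorBound, Fintype.prod_sum_type, Fintype.prod_unique, iTau, iGam]
    _ ≤ (4 ^ m * ((∏ i, ∏ j, (1 + |A i j|)) * ∏ i, (1 + |b i|))) *
        ((4 ^ n * ((∏ i, ∏ j, (1 + |A i j|)) * ∏ j, (1 + |c j|))) *
        ((4 * ((∏ i, (1 + |b i|)) * ∏ j, (1 + |c j|))) *
          (2 * dim m n * dataBound A b c))) := by
        gcongr
    _ = 4 ^ (m + n + 1) * (2 * dim m n) * dataBound A b c ^ 3 := by
        rw [dataBound]
        ring

lemma dataBound_mul_two_pow_le {Ai : Matrix (Fin m) (Fin n) ℤ} {bi : Fin m → ℤ} {ci : Fin n → ℤ}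
    (hA : ∀ i j, A i j = Ai i j) (hb : ∀ i, b i = bi i) (hc : ∀ j, c j = ci j) :
    dataBound A b c * 2 ^ (m * n + m + n) ≤ 2 ^ binaryLength Ai bi ci := by
  calc dataBound A b c * 2 ^ (m * n + m + n)
      ≤ (∏ i, ∏ j, 2 ^ Nat.clog 2 ((Ai i j).natAbs + 1)) *
        (∏ i, 2 ^ Nat.clog 2 ((bi i).natAbs + 1)) *
        (∏ j, 2 ^ Nat.clog 2 ((ci j).natAbs + 1)) * 2 ^ (m * n + m + n) := by
        simp only [dataBound, hA, hb, hc]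
        gcongr <;> exact one_add_abs_intCast_le_two_pow_clog _
    _ = 2 ^ binaryLength Ai bi ci := by
        simp only [Finset.prod_pow_eq_pow_sum, ← pow_add, binaryLength]
        congr 1
        ring

lemma add_le_binaryLength (Ai : Matrix (Fin m) (Fin n) ℤ) (bi : Fin m → ℤ) (ci : Fin n → ℤ) :
    m + n ≤ binaryLength Ai bi ci := by
  unfold binaryLength
  lia

lemma dim_le_two_pow (m n : ℕ) : dim m n ≤ 2 ^ (m + n + 1) := by
  have hlt : m + n + 1 + 1 ≤ 2 ^ (m + n + 1) := Nat.lt_two_pow_self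
  refine le_trans (le_of_eq ?_) (by exact_mod_cast hlt : ((m + n + 1 + 1 : ℕ) : ℝ) ≤ _)
  push_cast [dim]
  ring

lemma minorBound_conMatrix_le_two_pow (hn : 0 < n) {Ai : Matrix (Fin m) (Fin n) ℤ}
    {bi : Fin m → ℤ} {ci : Fin n → ℤ} (hA : ∀ i j, A i j = Ai i j) (hb : ∀ i, b i = bi i)
    (hc : ∀ j, c j = ci j) :
    minorBound (conMatrix A b c) ≤ 2 ^ (7 * binaryLength Ai bi ci) := by
  have hL := add_le_binaryLength Ai bi ci
  have hdata : 0 ≤ dataBound A b c := by unfold dataBound; positivity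
  have hpow : (2 : ℝ) ^ (m + n) ≤ 2 ^ (m * n + m + n) :=
    pow_le_pow_right₀ one_le_two (by lia)
  calc minorBound (conMatrix A b c)
      ≤ 4 ^ (m + n + 1) * (2 * dim m n) * dataBound A b c ^ 3 := minorBound_conMatrix_le
    _ ≤ 4 ^ (m + n + 1) * (2 * 2 ^ (m + n + 1)) * dataBound A b c ^ 3 := by
        gcongr
        exact dim_le_two_pow m n
    _ = 2 ^ 4 * (dataBound A b c * 2 ^ (m + n)) ^ 3 := by
        rw [show (4 : ℝ) = 2 ^ 2 by norm_num, ← pow_mul]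
        ring
    _ ≤ 2 ^ 4 * (2 ^ binaryLength Ai bi ci) ^ 3 := by
        gcongr
        exact (mul_le_mul_of_nonneg_left hpow hdata).trans (dataBound_mul_two_pow_le hA hb hc)
    _ ≤ 2 ^ (7 * binaryLength Ai bi ci) := by
        rw [← pow_mul, ← pow_add]
        exact pow_le_pow_right₀ one_le_two (by lia)

end Size

section Duality

variable {m n : ℕ} {A : Matrix (Fin m) (Fin n) ℝ} {b : Fin m → ℝ} {c : Fin n → ℝ}
  {P : Point m n}

-- Primal, dual and the two homogeneous systems of rays are the cases `σ, τ ∈ {0, 1}`.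
lemma homogeneous_weak_duality {x : Fin n → ℝ} {y : Fin m → ℝ} {σ τ : ℝ} (hx : 0 ≤ x)
    (hy : 0 ≤ y) (hAx : σ • b ≤ A *ᵥ x) (hAy : Aᵀ *ᵥ y ≤ τ • c) :
    σ * (b ⬝ᵥ y) ≤ τ * (c ⬝ᵥ x) := by
  calc σ * (b ⬝ᵥ y) = y ⬝ᵥ σ • b := by rw [dotProduct_smul, dotProduct_comm, smul_eq_mul]
    _ ≤ y ⬝ᵥ A *ᵥ x := dotProduct_le_dotProduct_of_nonneg_left hAx hy
    _ = x ⬝ᵥ Aᵀ *ᵥ y := by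
        rw [Matrix.dotProduct_mulVec, Matrix.mulVec_transpose, dotProduct_comm]
    _ ≤ x ⬝ᵥ τ • c := dotProduct_le_dotProduct_of_nonneg_left hAy hx
    _ = τ * (c ⬝ᵥ x) := by rw [dotProduct_smul, dotProduct_comm, smul_eq_mul]

lemma one_smul_le_mulVec {x : Fin n → ℝ} (hx : x ∈ primalFeasible A b) :
    (1 : ℝ) • b ≤ A *ᵥ x :=
  (one_smul ℝ b).trans_le hx.1

lemma transpose_mulVec_le_one_smul {y : Fin m → ℝ} (hy : y ∈ dualFeasible A c) :
    Aᵀ *ᵥ y ≤ (1 : ℝ) • c :=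
  (one_smul ℝ c).symm ▸ hy.1

lemma weak_duality {x : Fin n → ℝ} {y : Fin m → ℝ} (hx : x ∈ primalFeasible A b)
    (hy : y ∈ dualFeasible A c) : b ⬝ᵥ y ≤ c ⬝ᵥ x := by
  simpa only [one_mul] using homogeneous_weak_duality (σ := 1) (τ := 1) hx.2 hy.2
    (one_smul_le_mulVec hx) (transpose_mulVec_le_one_smul hy)

lemma isPrimalOptimal_and_isDualOptimal_of_le {x : Fin n → ℝ} {y : Fin m → ℝ}
    (hx : x ∈ primalFeasible A b) (hy : y ∈ dualFeasible A c) (h : c ⬝ᵥ x ≤ b ⬝ᵥ y) :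
    IsPrimalOptimal A b c x ∧ IsDualOptimal A b c y :=
  ⟨⟨hx, fun _ hv => h.trans (weak_duality hv hy)⟩, hy, fun _ hv => (weak_duality hx hv).trans h⟩

lemma xPart_nonneg (hP : P ∈ feasible A b c) : 0 ≤ xPart P := fun _ => hP.2.1 _

lemma yPart_nonneg (hP : P ∈ feasible A b c) : 0 ≤ yPart P := fun _ => hP.2.1 _

lemma smul_le_mulVec_xPart (hP : P ∈ feasible A b c) (hγ : var P (iGam m n) = 0) :
    var P (iTau m n) • b ≤ A *ᵥ xPart P := by
  intro i
  have hslk : slk P (.inl i) = (A *ᵥ xPart P) i - b i * var P (iTau m n) +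
      bBar A b i * var P (iGam m n) := by
    rw [hP.1]
    simp only [Pi.add_apply, Matrix.mulVec, dotProduct, sdMatrix, Matrix.of_apply, sdRhs,
      Fintype.sum_sum_type, iGam, iTau, xPart,
      Finset.sum_const_zero, Finset.sum_neg_distrib, Finset.univ_unique,
      PUnit.default_eq_unit, Finset.sum_singleton, reduceCtorEq, if_false, zero_mul, neg_mul,
      zero_add, add_zero]
    ring
  rw [hγ, mul_zero, add_zero] at hslk
  rw [Pi.smul_apply, smul_eq_mul]
  linarith [hP.2.2 (.inl i)]

lemma transpose_mulVec_yPart_le_smul (hP : P ∈ feasible A b c)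
    (hγ : var P (iGam m n) = 0) : Aᵀ *ᵥ yPart P ≤ var P (iTau m n) • c := by
  intro j
  have hslk : slk P (.inr (.inl j)) = -(Aᵀ *ᵥ yPart P) j + c j * var P (iTau m n) +
      cBar A c j * var P (iGam m n) := by
    rw [hP.1]
    simp only [Pi.add_apply, Matrix.mulVec, dotProduct, sdMatrix, Matrix.of_apply, sdRhs,
      Fintype.sum_sum_type, iGam, iTau, yPart, Matrix.transpose_apply, Sum.inr.injEq,
      Finset.sum_const_zero, Finset.sum_neg_distrib, Finset.univ_unique,
      PUnit.default_eq_unit, Finset.sum_singleton, reduceCtorEq, if_false, zero_mul, neg_mul,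
      zero_add, add_zero]
    ring
  rw [hγ, mul_zero, add_zero] at hslk
  rw [Pi.smul_apply, smul_eq_mul]
  linarith [hP.2.2 (.inr (.inl j))]

lemma slk_iTau (hP : SatisfiesEqs A b c P) (hγ : var P (iGam m n) = 0) :
    slk P (iTau m n) = b ⬝ᵥ yPart P - c ⬝ᵥ xPart P := by
  have hslk : slk P (iTau m n) = b ⬝ᵥ yPart P - c ⬝ᵥ xPart P + oBar b c * var P (iGam m n) := by
    rw [hP]
    simp only [Pi.add_apply, Matrix.mulVec, dotProduct, sdMatrix, Matrix.of_apply, sdRhs,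
      Fintype.sum_sum_type, iGam, iTau, xPart, yPart, Sum.inr.injEq,
      Finset.sum_const_zero, Finset.sum_neg_distrib, Finset.univ_unique,
      PUnit.default_eq_unit, Finset.sum_singleton, reduceCtorEq, if_false, zero_mul, neg_mul,
      zero_add, add_zero]
    ring
  rwa [hγ, mul_zero, add_zero] at hslk

lemma optimal_of_tau_pos (hP : P ∈ feasible A b c) (hγ : var P (iGam m n) = 0)
    (hτ : 0 < var P (iTau m n)) :
    IsPrimalOptimal A b c (fun j => xPart P j / var P (iTau m n)) ∧
      IsDualOptimal A b c (fun i => yPart P i / var P (iTau m n)) := by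
  set τ := var P (iTau m n)
  have hτ' : 0 ≤ τ⁻¹ := (inv_pos.2 hτ).le
  have hcancel {k : ℕ} (v : Fin k → ℝ) : τ⁻¹ • τ • v = v := inv_smul_smul₀ hτ.ne' v
  have hx : τ⁻¹ • xPart P ∈ primalFeasible A b := by
    refine ⟨?_, smul_nonneg hτ' (xPart_nonneg hP)⟩
    rw [Matrix.mulVec_smul, ← hcancel b]
    exact smul_le_smul_of_nonneg_left (smul_le_mulVec_xPart hP hγ) hτ'
  have hy : τ⁻¹ • yPart P ∈ dualFeasible A c := by
    refine ⟨?_, smul_nonneg hτ' (yPart_nonneg hP)⟩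
    rw [Matrix.mulVec_smul, ← hcancel c]
    exact smul_le_smul_of_nonneg_left (transpose_mulVec_yPart_le_smul hP hγ) hτ'
  have hgap : c ⬝ᵥ (τ⁻¹ • xPart P) ≤ b ⬝ᵥ (τ⁻¹ • yPart P) := by
    rw [dotProduct_smul, dotProduct_smul]
    refine mul_le_mul_of_nonneg_left ?_ hτ'
    exact sub_nonneg.1 ((hP.2.2 _).trans_eq (slk_iTau hP.1 hγ))
  simpa only [Pi.smul_def, smul_eq_mul, ← div_eq_inv_mul] using
    isPrimalOptimal_and_isDualOptimal_of_le hx hy hgap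

lemma infeasible_of_tau_eq_zero (hP : P ∈ feasible A b c) (hγ : var P (iGam m n) = 0)
    (hτ : var P (iTau m n) = 0) (hφ : 0 < slk P (iTau m n)) :
    primalFeasible A b = ∅ ∨ dualFeasible A c = ∅ := by
  by_contra! hne
  obtain ⟨⟨x, hx⟩, y, hy⟩ := hne
  have hAx := smul_le_mulVec_xPart hP hγ
  have hAy := transpose_mulVec_yPart_le_smul hP hγ
  rw [hτ] at hAx hAy
  have hcx := homogeneous_weak_duality (τ := 1) (xPart_nonneg hP) hy.2 hAx
    (transpose_mulVec_le_one_smul hy)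
  have hby := homogeneous_weak_duality (σ := 1) hx.2 (yPart_nonneg hP)
    (one_smul_le_mulVec hx) hAy
  linarith [slk_iTau hP.1 hγ]

end Duality

section ExactRounding

variable {m n : ℕ} {A : Matrix (Fin m) (Fin n) ℝ} {b : Fin m → ℝ} {c : Fin n → ℝ}
  {Ai : Matrix (Fin m) (Fin n) ℤ} {bi : Fin m → ℤ} {ci : Fin n → ℤ} {θ : ℝ}
  {X : ℕ → Point m n} {P : Point m n} {k : ℕ}

lemma IsStrictOptimal.optimal_or_infeasible (hP : IsStrictOptimal A b c P) :
    (0 < var P (iTau m n) →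
      IsPrimalOptimal A b c (fun j => xPart P j / var P (iTau m n)) ∧
      IsDualOptimal A b c (fun i => yPart P i / var P (iTau m n))) ∧
    (var P (iTau m n) = 0 → primalFeasible A b = ∅ ∨ dualFeasible A c = ∅) := by
  have hγ : var P (iGam m n) = 0 := hP.1.1.mu_eq.symm.trans hP.mu_eq_zero
  refine ⟨optimal_of_tau_pos hP.1 hγ, fun hτ => infeasible_of_tau_eq_zero hP.1 hγ hτ ?_⟩
  have hpos := (hP.2.2 (iTau m n)).2
  rwa [hτ, zero_add] at hpos

lemma conMatrix_mem_range_intCast (hA : ∀ i j, A i j = Ai i j) (hb : ∀ i, b i = bi i)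
    (hc : ∀ j, c j = ci j) (p : Idx m n) (q : Idx m n ⊕ Idx m n) :
    conMatrix A b c p q ∈ (Int.castRingHom ℝ).range :=
  conMatrix_mem (fun i j => RingHom.mem_range.2 ⟨Ai i j, (hA i j).symm⟩)
    (fun i => RingHom.mem_range.2 ⟨bi i, (hb i).symm⟩)
    (fun j => RingHom.mem_range.2 ⟨ci j, (hc j).symm⟩) p q

lemma two_pow_le_exp (k : ℕ) : (2 : ℝ) ^ k ≤ Real.exp k := by
  rw [← Real.exp_one_pow]
  exact pow_le_pow_left₀ two_pos.le Real.exp_one_gt_two.le k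

lemma two_mul_dim_pow_mul_minorBound_pow_le (hn : 0 < n) (hA : ∀ i j, A i j = Ai i j)
    (hb : ∀ i, b i = bi i) (hc : ∀ j, c j = ci j) :
    2 * (2 * dim m n ^ 3 * minorBound (conMatrix A b c) ^ 4) ≤
      Real.exp (36 * binaryLength Ai bi ci) := by
  set L := binaryLength Ai bi ci
  have hL : m + n ≤ L := add_le_binaryLength Ai bi ci
  have hdim : 0 ≤ dim m n := (dim_pos m n).le
  have hminor : 0 ≤ minorBound (conMatrix A b c) := zero_le_one.trans (one_le_minorBound _)
  calc 2 * (2 * dim m n ^ 3 * minorBound (conMatrix A b c) ^ 4)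
      ≤ 2 * (2 * (2 ^ (m + n + 1)) ^ 3 * (2 ^ (7 * L)) ^ 4) := by
        gcongr
        · exact dim_le_two_pow m n
        · exact minorBound_conMatrix_le_two_pow hn hA hb hc
    _ = 2 ^ (3 * (m + n) + 28 * L + 5) := by ring
    _ ≤ 2 ^ (36 * L) := pow_le_pow_right₀ one_le_two (by lia)
    _ ≤ Real.exp (36 * L) := by exact_mod_cast two_pow_le_exp (36 * L)

lemma IsRun.exists_isRounding_isStrictOptimal (hX : IsRun A b c θ X)
    (hθ : θ ∈ Set.Icc (2 / 10) (4 / 10)) (hμ₀ : mu (X 0) ≤ 1) (hn : 0 < n)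
    (hA : ∀ i j, A i j = Ai i j) (hb : ∀ i, b i = bi i) (hc : ∀ j, c j = ci j)
    (hk : 3600 * √(dim m n) * binaryLength Ai bi ci ≤ k) :
    ∃ P, IsRounding A b c (X k) P ∧ (∀ Q, IsRounding A b c (X k) Q → Q = P) ∧
      IsStrictOptimal A b c P := by
  obtain ⟨Z, hZ⟩ := exists_isStrictOptimal (hX.mem_nbhd hθ) (hθ.2.trans_lt (by norm_num))
    (hX.tendsto_mu hθ)
  refine exists_unique_isRounding_isStrictOptimal (conMatrix_mem_range_intCast hA hb hc)
    (hX.mem_nbhd hθ k) hZ ?_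
  set K := 2 * dim m n ^ 3 * minorBound (conMatrix A b c) ^ 4
  set E := 36 * (binaryLength Ai bi ci : ℝ)
  have hK : 2 * K ≤ Real.exp E := two_mul_dim_pow_mul_minorBound_pow_le hn hA hb hc
  have hμ : mu (X k) ≤ Real.exp (-E) := by
    have hdecay := hX.mu_le_exp hθ (k := k) (t := E) (by linarith)
    exact hdecay.trans (mul_le_of_le_one_right (Real.exp_pos _).le hμ₀)
  have hhalf : 2 * K * mu (X k) ≤ 1 :=
    calc 2 * K * mu (X k) ≤ Real.exp E * Real.exp (-E) :=
          mul_le_mul hK hμ (hX.mu_pos hθ k).le (Real.exp_pos _).le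
      _ = 1 := by rw [← Real.exp_add, add_neg_cancel, Real.exp_zero]
  linarith [hθ.2]

end ExactRounding

end SelfDual

open SelfDual in
theorem mainTheorem2_general :
    ∃ C : ℝ, 0 < C ∧
      ∀ θ ∈ Set.Icc (2 / 10 : ℝ) (4 / 10),
      ∀ (m n : ℕ) (A : Matrix (Fin m) (Fin n) ℝ) (b : Fin m → ℝ) (c : Fin n → ℝ),
        (ones m n ∈ nbhd A b c θ ∧ mu (ones m n) = 1 ∧
          ∀ Z ∈ nbhd A b c θ, ∃ Znext, Step A b c Z Znext) ∧
        ∀ X : ℕ → Point m n, IsRun A b c θ X →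
          (Tendsto (fun k => mu (X k)) atTop (𝓝 0) ∧
            ∀ k, mu (X (k + 1)) ≤
              (1 - (1 / 100) / √(dim m n)) * mu (X k)) ∧
          (∀ k, X k ∈ nbhd A b c θ) ∧
          ∀ κ : ℝ, (n : ℝ) + m + 2 ≤ κ * n →
            (∀ ζ : ℝ, 0 < ζ → ∀ k : ℕ,
              C * √κ * √n * Real.log (mu (X 0) / ζ) ≤ k →
                X k ∈ zetaOptimal A b c ζ) ∧
            (mu (X 0) ≤ 1 →
              (∀ ζ : ℝ, 0 < ζ → ∀ k : ℕ,
                C * √κ * √n * Real.log (1 / ζ) ≤ k →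
                  X k ∈ zetaOptimal A b c ζ) ∧
              ∀ (Ai : Matrix (Fin m) (Fin n) ℤ) (bi : Fin m → ℤ) (ci : Fin n → ℤ),
                (∀ i j, A i j = (Ai i j : ℝ)) → (∀ i, b i = (bi i : ℝ)) →
                (∀ j, c j = (ci j : ℝ)) → ∀ k : ℕ,
                C * √κ * √n * (binaryLength Ai bi ci : ℝ) ≤ k →
                  ∃ P : Point m n,
                    IsRounding A b c (X k) P ∧
                    (∀ Q, IsRounding A b c (X k) Q → Q = P) ∧
                    IsStrictOptimal A b c P ∧
                    (0 < var P (iTau m n) →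
                      IsPrimalOptimal A b c
                        (fun j => xPart P j / var P (iTau m n)) ∧
                      IsDualOptimal A b c
                        (fun i => yPart P i / var P (iTau m n))) ∧
                    (var P (iTau m n) = 0 →
                      primalFeasible A b = ∅ ∨ dualFeasible A c = ∅)) := by
  refine ⟨3600, by norm_num, fun θ hθ m n A b c =>
    ⟨⟨ones_mem_nbhd (hθ.1.trans' (by norm_num)), mu_ones, fun Z hZ => exists_step hZ.1⟩,
      fun X hX => ⟨⟨hX.tendsto_mu hθ, hX.mu_succ_le hθ⟩, hX.mem_nbhd hθ, fun κ hκ => ?_⟩⟩⟩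
  have hiter : ∀ {a t : ℝ} {k : ℕ}, 0 ≤ a → a ≤ 3600 → 3600 * √κ * √n * t ≤ k →
      a * √(dim m n) * t ≤ k := mul_sqrt_dim_mul_le hκ
  have hzeta : ∀ μ₀, mu (X 0) ≤ μ₀ → ∀ ζ, 0 < ζ → ∀ k : ℕ,
      3600 * √κ * √n * Real.log (μ₀ / ζ) ≤ k → X k ∈ zetaOptimal A b c ζ :=
    fun μ₀ hμ₀ ζ hζ k hk =>
      hX.mem_zetaOptimal hθ hζ hμ₀ (hiter (by norm_num) (by norm_num) hk)
  refine ⟨hzeta _ le_rfl, fun hμ₀ => ⟨hzeta 1 hμ₀, fun Ai bi ci hA hb hc k hk => ?_⟩⟩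
  obtain ⟨P, hP, huniq, hopt⟩ := hX.exists_isRounding_isStrictOptimal hθ hμ₀
    (pos_of_add_add_two_le_mul hκ) hA hb hc (hiter (by norm_num) le_rfl hk)
  exact ⟨P, hP, huniq, hopt, hopt.optimal_or_infeasible⟩

theorem mainTheorem2 :
    ∃ C : ℝ, 0 < C ∧
      ∀ (θ : ℝ), (θ = 2 / 10 ∨ θ = 3 / 10) →
      ∀ (m n : ℕ) (A : Matrix (Fin m) (Fin n) ℝ) (b : Fin m → ℝ) (c : Fin n → ℝ),
        -- the all-one vector is a legitimate start with `μ = 1`, and the loop never gets stuck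
        (SelfDual.ones m n ∈ SelfDual.nbhd A b c θ ∧ SelfDual.mu (SelfDual.ones m n) = 1 ∧
          ∀ Z ∈ SelfDual.nbhd A b c θ, ∃ Znext, SelfDual.Step A b c Z Znext) ∧
        ∀ X : ℕ → SelfDual.Point m n, SelfDual.IsRun A b c θ X →
          -- linear convergence of `μ` to zero
          (Tendsto (fun k => SelfDual.mu (X k)) atTop (𝓝 0) ∧
            ∀ k, SelfDual.mu (X (k + 1)) ≤
              (1 - (1 / 100) / Real.sqrt (SelfDual.dim m n)) * SelfDual.mu (X k)) ∧
          -- all iterates stay in the neighborhood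
          (∀ k, X k ∈ SelfDual.nbhd A b c θ) ∧
          -- iteration bounds, when `n + m + 2 ≤ κ n`
          ∀ κ : ℝ, (n : ℝ) + m + 2 ≤ κ * n →
            (∀ ζ : ℝ, 0 < ζ → ∀ k : ℕ,
              C * Real.sqrt κ * Real.sqrt n * Real.log (SelfDual.mu (X 0) / ζ) ≤ k →
                X k ∈ SelfDual.zetaOptimal A b c ζ) ∧
            (SelfDual.mu (X 0) ≤ 1 →
              (∀ ζ : ℝ, 0 < ζ → ∀ k : ℕ,
                C * Real.sqrt κ * Real.sqrt n * Real.log (1 / ζ) ≤ k →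
                  X k ∈ SelfDual.zetaOptimal A b c ζ) ∧
              -- exact solutions, for integer data
              ∀ (Ai : Matrix (Fin m) (Fin n) ℤ) (bi : Fin m → ℤ) (ci : Fin n → ℤ),
                (∀ i j, A i j = (Ai i j : ℝ)) → (∀ i, b i = (bi i : ℝ)) →
                (∀ j, c j = (ci j : ℝ)) → ∀ k : ℕ,
                C * Real.sqrt κ * Real.sqrt n * (SelfDual.binaryLength Ai bi ci : ℝ) ≤ k →
                  ∃ P : SelfDual.Point m n,
                    SelfDual.IsRounding A b c (X k) P ∧
                    (∀ Q, SelfDual.IsRounding A b c (X k) Q → Q = P) ∧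
                    SelfDual.IsStrictOptimal A b c P ∧
                    (0 < SelfDual.var P (SelfDual.iTau m n) →
                      SelfDual.IsPrimalOptimal A b c
                        (fun j => SelfDual.xPart P j / SelfDual.var P (SelfDual.iTau m n)) ∧
                      SelfDual.IsDualOptimal A b c
                        (fun i => SelfDual.yPart P i / SelfDual.var P (SelfDual.iTau m n))) ∧
                    (SelfDual.var P (SelfDual.iTau m n) = 0 →
                      SelfDual.primalFeasible A b = ∅ ∨ SelfDual.dualFeasible A c = ∅)) := by
  obtain ⟨C, hC, h⟩ := mainTheorem2_general
  exact ⟨C, hC, fun θ hθ => h θ (by rcases hθ with rfl | rfl <;> norm_num)⟩
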